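/- A matrix $M\in\mathbb F^{m\times n}$ is called $(m,n,r,\tau)$-row rigid if every matrix that differs from $M$ in at most $\tau$ entries in each row has rank at least $r$, and $(m,n,r,\tau)$-globally rigid if every matrix that differs from $M$ in at most $\tau$ entries in total has rank at least $r$. There is an absolute constant $C>0$ such that for every finite field $\mathbb F$ and every constant $\alpha>0$ there is an algorithm (a program for a unit-cost random access machine over $\mathbb F$) with the following property. Let $n\le m$ be non-negative integers. On input $M\in\mathbb F^{m\times n}$ it halts after a number of steps bounded by a polynomial in $m+n$ (the polynomial depends only on $\mathbb F$ and $\alpha$), and it outputs a square matrix $A\in\mathbb F^{m'\times m'}$ with $$m'\le m^{C(1+1/\alpha)}.$$ For all non-negative integers $r,t$ for which $M$ is $(m,n,r,t+1)$-row rigid, the matrix $A$ is $$\left(m',m',r,\ \frac{m'^2}{n}\cdot\frac{t}{(\log m)^{1+\alpha}}\right)\text{-globally rigid},$$ and in particular $$\left(m',m',r,\ \frac{m'}{n}\cdot\frac{t}{(\log m)^{1+\alpha}}\right)\text{-row rigid}.$$ Here $\log$ is the natural logarithm, and an expression with a zero denominator is read as $0$ (this matters only for $m\le 1$ or $n=0$).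 -/

import Mathlib

/-! ## Rigidity of matrices -/

/-- `M` is `(m, n, r, t)`-row rigid: every matrix that differs from `M` in at most `t` entries
in each row has rank at least `r`. -/
def RowRigid {F : Type*} [Field F] [DecidableEq F] {m n : ℕ}
    (M : Matrix (Fin m) (Fin n) F) (r : ℕ) (t : ℝ) : Prop :=
  ∀ B : Matrix (Fin m) (Fin n) F,
    (∀ i, (hammingDist (M i) (B i) : ℝ) ≤ t) → r ≤ B.rank

/-- `M` is `(m, n, r, t)`-globally rigid: every matrix that differs from `M` in at most `t`
entries in total has rank at least `r`. -/
def GloballyRigid {F : Type*} [Field F] [DecidableEq F] {m n : ℕ}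
    (M : Matrix (Fin m) (Fin n) F) (r : ℕ) (t : ℝ) : Prop :=
  ∀ B : Matrix (Fin m) (Fin n) F,
    ((∑ i, hammingDist (M i) (B i) : ℕ) : ℝ) ≤ t → r ≤ B.rank

/-! ## A random access machine

Unit-cost random access machine with structured control flow, over a fixed finite field `F`.
It has a memory of natural numbers and a memory of field elements, both addressed by natural
numbers and with indirect addressing. On natural numbers there are only constants, addition and
truncated subtraction (no multiplication), so that a number computed in `T` steps has at most
`O(T)` more bits than the input numbers, and unit cost is polynomially equivalent to the
running time of a Turing machine. -/

namespace RAM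

/-- Expressions with values in `ℕ`. -/
inductive NatExpr : Type
  | const (c : ℕ) : NatExpr
  | load (addr : NatExpr) : NatExpr
  | add (a b : NatExpr) : NatExpr
  | sub (a b : NatExpr) : NatExpr

/-- Expressions with values in `F`. -/
inductive FieldExpr (F : Type*) : Type _
  | const (c : F) : FieldExpr F
  | load (addr : NatExpr) : FieldExpr F
  | add (a b : FieldExpr F) : FieldExpr F
  | sub (a b : FieldExpr F) : FieldExpr F
  | mul (a b : FieldExpr F) : FieldExpr F
  | inv (a : FieldExpr F) : FieldExpr F

/-- Programs. `setNat a e` and `setField a e` store the value of `e` at the address given by the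
value of `a`, in the number memory and in the field memory respectively. The tests `ifNat`,
`whileNat` and `ifField` ask whether the value of the expression is nonzero. -/
inductive Program (F : Type*) : Type _
  | skip : Program F
  | setNat (a e : NatExpr) : Program F
  | setField (a : NatExpr) (e : FieldExpr F) : Program F
  | seq (p q : Program F) : Program F
  | ifNat (e : NatExpr) (p q : Program F) : Program F
  | ifField (e : FieldExpr F) (p q : Program F) : Program F
  | whileNat (e : NatExpr) (p : Program F) : Program F

/-- The contents of the two memories. -/
@[ext]
structure State (F : Type*) where
  nat : ℕ → ℕ
  field : ℕ → F

/-- The value of a number expression, given the contents of the number memory. -/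
def NatExpr.eval (μ : ℕ → ℕ) : NatExpr → ℕ
  | .const c => c
  | .load a => μ (a.eval μ)
  | .add a b => a.eval μ + b.eval μ
  | .sub a b => a.eval μ - b.eval μ

/-- The number of steps needed to evaluate a number expression: one for each node. -/
def NatExpr.cost : NatExpr → ℕ
  | .const _ => 1
  | .load a => a.cost + 1
  | .add a b => a.cost + b.cost + 1
  | .sub a b => a.cost + b.cost + 1

/-- The value of a field expression. -/
def FieldExpr.eval {F : Type*} [Field F] (s : State F) : FieldExpr F → F
  | .const c => c
  | .load a => s.field (a.eval s.nat)
  | .add a b => a.eval s + b.eval s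
  | .sub a b => a.eval s - b.eval s
  | .mul a b => a.eval s * b.eval s
  | .inv a => (a.eval s)⁻¹

/-- The number of steps needed to evaluate a field expression: one for each node. -/
def FieldExpr.cost {F : Type*} : FieldExpr F → ℕ
  | .const _ => 1
  | .load a => a.cost + 1
  | .add a b => a.cost + b.cost + 1
  | .sub a b => a.cost + b.cost + 1
  | .mul a b => a.cost + b.cost + 1
  | .inv a => a.cost + 1

/-- `Run p s T s'`: the program `p`, started in the state `s`, halts after exactly `T` steps in
the state `s'`. -/
inductive Run {F : Type*} [Field F] : Program F → State F → ℕ → State F → Prop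
  | skip (s : State F) : Run .skip s 1 s
  | setNat (a e : NatExpr) (s : State F) :
      Run (.setNat a e) s (a.cost + e.cost + 1)
        { s with nat := Function.update s.nat (a.eval s.nat) (e.eval s.nat) }
  | setField (a : NatExpr) (e : FieldExpr F) (s : State F) :
      Run (.setField a e) s (a.cost + e.cost + 1)
        { s with field := Function.update s.field (a.eval s.nat) (e.eval s) }
  | seq {p q : Program F} {s₁ s₂ s₃ : State F} {T₁ T₂ : ℕ} :
      Run p s₁ T₁ s₂ → Run q s₂ T₂ s₃ → Run (.seq p q) s₁ (T₁ + T₂) s₃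
  | ifNat_true {e : NatExpr} {p q : Program F} {s s' : State F} {T : ℕ} :
      e.eval s.nat ≠ 0 → Run p s T s' → Run (.ifNat e p q) s (e.cost + T + 1) s'
  | ifNat_false {e : NatExpr} {p q : Program F} {s s' : State F} {T : ℕ} :
      e.eval s.nat = 0 → Run q s T s' → Run (.ifNat e p q) s (e.cost + T + 1) s'
  | ifField_true {e : FieldExpr F} {p q : Program F} {s s' : State F} {T : ℕ} :
      e.eval s ≠ 0 → Run p s T s' → Run (.ifField e p q) s (e.cost + T + 1) s'
  | ifField_false {e : FieldExpr F} {p q : Program F} {s s' : State F} {T : ℕ} :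
      e.eval s = 0 → Run q s T s' → Run (.ifField e p q) s (e.cost + T + 1) s'
  | while_done {e : NatExpr} {p : Program F} {s : State F} :
      e.eval s.nat = 0 → Run (.whileNat e p) s (e.cost + 1) s
  | while_step {e : NatExpr} {p : Program F} {s₁ s₂ s₃ : State F} {T₁ T₂ : ℕ} :
      e.eval s₁.nat ≠ 0 → Run p s₁ T₁ s₂ → Run (.whileNat e p) s₂ T₂ s₃ →
        Run (.whileNat e p) s₁ (e.cost + T₁ + T₂ + 1) s₃

/-- The initial state on input `M`, an `m × n` matrix: the numbers `m` and `n` stand in cells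
`0` and `1` of the number memory, the entries of `M` stand row by row in the first `m * n` cells
of the field memory, and all other cells are `0`. -/
def inputState {F : Type*} [Field F] {m n : ℕ} (M : Matrix (Fin m) (Fin n) F) : State F where
  nat k := if k = 0 then m else if k = 1 then n else 0
  field k := if h : k < m * n then
      M (finProdFinEquiv.symm ⟨k, h⟩).1 (finProdFinEquiv.symm ⟨k, h⟩).2
    else 0

/-- The output of a halting state is the square `m' × m'` matrix `A`: the number `m'` stands in
cell `0` of the number memory, and the entries of `A` stand row by row in the first `m' * m'`
cells of the field memory. -/
def Outputs {F : Type*} (s : State F) {m' : ℕ} (A : Matrix (Fin m') (Fin m') F) : Prop :=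
  s.nat 0 = m' ∧ ∀ i j : Fin m', s.field ((i : ℕ) * m' + (j : ℕ)) = A i j

end RAM

/-! Let `E` be the `N × m` generator matrix of a linear code over `F`, and let `A` be `E * M` with
its `n` columns repeated periodically up to `N` columns. The code is smoothly decodable: every
message coordinate is minus the sum of `Q - 1` codeword coordinates, and these can be drawn at
random so that each single queried position is uniform. Suppose that `B` differs from `A` in few
entries. Some block of `n` consecutive columns carries at most its share of the differences, and
inside this block averaging yields, for each row of `M`, a set of queries whose rows contain at most
`t` differences altogether. Negated sums of the queried rows of `B` then form a matrix that differs
from `M` in at most `t` entries per row, so its rank is at least `r`; its rows are combinations of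
rows of a submatrix of `B`. This is `globallyRigid_of_smooth`.

The code is of Reed-Muller type. Messages are interpolated on a grid of `g ^ l ≥ m` points by
polynomials in `l` variables, of degree less than `g` in each, over an extension field `K` of `F`
with `Q` elements; the values are sent to `F` by the constant coefficient, an `F`-linear map. If `l
* (g - 1) < Q - 1`, the values along a line sum to zero, so the value at a grid point is minus the
sum over the rest of any line through it (`exists_smooth_decoding`). Choose `b > 1 / α`, let `g` be
a power of `q = |F|` with `g ^ b` just above the binary length of `m`, and put `Q = g ^ (b + 1)`.
Then `Q = O((log m) ^ (1 + 1 / b))`, which is below `(log m) ^ (1 + α) / 2` for large `m`, and `N =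
Q ^ l ≤ (m * g) ^ (b + 1)` is polynomial in `m` (`eventually_parameters`, `codeLen_eq`).

The finitely many remaining `m` are served by hard-coded matrices that ignore `M`: by counting there
is a matrix far from all matrices of rank at most `m` (`exists_rigid_matrix`), and a matrix with `n
≤ m` columns is never row rigid enough to demand more (`exists_matrix_of_small`).

For the running time, a calculus of functions computable in time polynomial in the values of their
arguments (`PolyTime`) suffices. Elements of `K` are numbers below `Q`, and `Q` is itself
polynomially bounded, so irreducible polynomials, products and inverses can be found by exhaustive
search. `exists_program` turns such functions into a machine. -/

namespace RAM

/-! ### Reasoning about programs -/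

/-- The program `p`, started in `s`, halts within `τ` steps in a state that satisfies `R`. -/
def Ends {F : Type*} [Field F] (p : Program F) (s : State F) (τ : ℕ) (R : State F → Prop) : Prop :=
  ∃ T s', Run p s T s' ∧ T ≤ τ ∧ R s'

section
variable {F : Type*} [Field F]

theorem Ends.mono {p : Program F} {s : State F} {τ τ' : ℕ} {R R' : State F → Prop}
    (h : Ends p s τ R) (hτ : τ ≤ τ') (hR : ∀ s, R s → R' s) : Ends p s τ' R' := by
  obtain ⟨T, s', h₁, h₂, h₃⟩ := h
  exact ⟨T, s', h₁, h₂.trans hτ, hR _ h₃⟩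

theorem Ends.seq {p q : Program F} {s : State F} {τ₁ τ₂ : ℕ} {R R' : State F → Prop}
    (h : Ends p s τ₁ R) (h' : ∀ s, R s → Ends q s τ₂ R') : Ends (.seq p q) s (τ₁ + τ₂) R' := by
  obtain ⟨T, s', h₁, h₂, h₃⟩ := h
  obtain ⟨T', s'', h₁', h₂', h₃'⟩ := h' s' h₃
  exact ⟨_, _, .seq h₁ h₁', by omega, h₃'⟩

theorem ends_setNat (a e : NatExpr) (s : State F) :
    Ends (.setNat a e) s (a.cost + e.cost + 1)
      (fun s' => s' = { s with nat := Function.update s.nat (a.eval s.nat) (e.eval s.nat) }) :=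
  ⟨_, _, .setNat a e s, le_rfl, rfl⟩

theorem ends_setField (a : NatExpr) (e : FieldExpr F) (s : State F) :
    Ends (.setField a e) s (a.cost + e.cost + 1)
      (fun s' => s' = { s with field := Function.update s.field (a.eval s.nat) (e.eval s) }) :=
  ⟨_, _, .setField a e s, le_rfl, rfl⟩

/-- The rule for loops that make `n` rounds, with an invariant indexed by the round. -/
theorem ends_while {e : NatExpr} {p : Program F} (I : ℕ → State F → Prop) (n τ : ℕ)
    (hstep : ∀ i < n, ∀ s, I i s → e.eval s.nat ≠ 0 ∧ Ends p s τ (I (i + 1)))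
    (hend : ∀ s, I n s → e.eval s.nat = 0) {s : State F} (h0 : I 0 s) :
    Ends (.whileNat e p) s (n * (τ + e.cost + 1) + e.cost + 1) (I n) := by
  suffices h : ∀ k i, i + k = n → ∀ s, I i s →
      Ends (.whileNat e p) s (k * (τ + e.cost + 1) + e.cost + 1) (I n) from
    h n 0 (by omega) s h0
  intro k
  induction k with
  | zero =>
    intro i hi s hs
    obtain rfl : i = n := by omega
    exact ⟨_, _, .while_done (hend s hs), by omega, hs⟩
  | succ k ih =>
    intro i hi s hs
    obtain ⟨h1, T, s', h2, h3, h4⟩ := hstep i (by omega) s hs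
    obtain ⟨T', s'', h5, h6, h7⟩ := ih (i + 1) (by omega) s' h4
    refine ⟨_, _, .while_step h1 h2 h5, ?_, h7⟩
    rw [add_mul]
    omega

end

/-! ### Polynomially bounded functions -/

/-- The function `b` is bounded by a polynomial in the sum of its arguments. -/
def PolyBdd {j : ℕ} (b : (Fin j → ℕ) → ℕ) : Prop :=
  ∃ e : ℕ, ∀ v, b v ≤ (∑ i, v i + 2) ^ e

section
variable {j : ℕ}

theorem PolyBdd.mono {b c : (Fin j → ℕ) → ℕ} (hc : PolyBdd c) (h : ∀ v, b v ≤ c v) :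
    PolyBdd b := by
  obtain ⟨e, he⟩ := hc
  exact ⟨e, fun v => (h v).trans (he v)⟩

theorem PolyBdd.const (c : ℕ) : PolyBdd (fun _ : Fin j → ℕ => c) :=
  ⟨c, fun v => (Nat.lt_two_pow_self (n := c)).le.trans (Nat.pow_le_pow_left (by omega) c)⟩

theorem polyBdd_sum_args : PolyBdd (fun v : Fin j → ℕ => ∑ i, v i) :=
  ⟨1, fun v => by simp⟩

theorem PolyBdd.proj (i : Fin j) : PolyBdd (fun v : Fin j → ℕ => v i) :=
  polyBdd_sum_args.mono fun v => Finset.single_le_sum (f := v) (fun _ _ => Nat.zero_le _)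
    (Finset.mem_univ i)

theorem PolyBdd.mul {b c : (Fin j → ℕ) → ℕ} (hb : PolyBdd b) (hc : PolyBdd c) :
    PolyBdd (fun v => b v * c v) := by
  obtain ⟨e, he⟩ := hb
  obtain ⟨e', he'⟩ := hc
  exact ⟨e + e', fun v => by rw [pow_add]; exact Nat.mul_le_mul (he v) (he' v)⟩

theorem PolyBdd.one_add {b : (Fin j → ℕ) → ℕ} (hb : PolyBdd b) : PolyBdd (fun v => 1 + b v) := by
  obtain ⟨e, he⟩ := hb
  refine ⟨e + 1, fun v => ?_⟩
  have h1 := he v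
  have h2 : 1 ≤ (∑ i, v i + 2) ^ e := Nat.one_le_pow _ _ (by omega)
  rw [pow_succ]
  nlinarith [Nat.zero_le (∑ i, v i)]

theorem PolyBdd.add {b c : (Fin j → ℕ) → ℕ} (hb : PolyBdd b) (hc : PolyBdd c) :
    PolyBdd (fun v => b v + c v) :=
  (hb.one_add.mul hc.one_add).mono fun v => by nlinarith [Nat.zero_le (b v * c v)]

theorem PolyBdd.pow {b : (Fin j → ℕ) → ℕ} (hb : PolyBdd b) (e : ℕ) :
    PolyBdd (fun v => b v ^ e) := by
  induction e with
  | zero => simpa using PolyBdd.const 1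
  | succ e ih => simpa only [pow_succ] using ih.mul hb

theorem PolyBdd.sum {ι : Type*} (s : Finset ι) {b : ι → (Fin j → ℕ) → ℕ}
    (hb : ∀ i ∈ s, PolyBdd (b i)) : PolyBdd (fun v => ∑ i ∈ s, b i v) := by
  classical
  induction s using Finset.induction_on with
  | empty => simpa using PolyBdd.const 0
  | insert i s hi ih =>
    simp only [Finset.sum_insert hi]
    exact (hb i (by simp)).add (ih fun k hk => hb k (by simp [hk]))

theorem PolyBdd.comp {k : ℕ} {b : (Fin k → ℕ) → ℕ} {g : Fin k → (Fin j → ℕ) → ℕ}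
    (hb : PolyBdd b) (hg : ∀ i, PolyBdd (g i)) : PolyBdd (fun v => b (fun i => g i v)) := by
  obtain ⟨e, he⟩ := hb
  exact (((PolyBdd.sum Finset.univ fun i _ => hg i).add (.const 2)).pow e).mono fun v => he _

/-! ### Functions computed in polynomial time -/

/-- The function `f` of natural numbers is computed in time polynomial in the values of its
arguments, with results so bounded: for all cells `addr i` holding the arguments and every cell
`d` beyond them, some program puts the value into `d` and changes no cell before `d`. -/
def PolyTime (F : Type*) [Field F] {j : ℕ} (f : (Fin j → ℕ) → ℕ) : Prop :=
  PolyBdd f ∧ ∃ τ : (Fin j → ℕ) → ℕ, PolyBdd τ ∧ ∀ (addr : Fin j → ℕ) (d : ℕ),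
    (∀ i, addr i < d) → ∃ p : Program F, ∀ s : State F,
      Ends p s (τ fun i => s.nat (addr i)) (fun s' =>
        s'.nat d = f (fun i => s.nat (addr i)) ∧ (∀ i < d, s'.nat i = s.nat i) ∧
          s'.field = s.field)

namespace PolyTime

variable {F : Type*} [Field F]

theorem proj (i : Fin j) : PolyTime F (fun v => v i) := by
  refine ⟨.proj i, fun _ => 4, .const 4, fun addr d h => ⟨.setNat (.const d) (.load (.const (addr i))),
    fun s => (ends_setNat _ _ _).mono (by simp [NatExpr.cost]) ?_⟩⟩
  rintro _ rfl
  refine ⟨by simp [NatExpr.eval], fun i hi => ?_, rfl⟩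
  simp [NatExpr.eval, Function.update_of_ne hi.ne]

theorem const (c : ℕ) : PolyTime F (fun _ : Fin j → ℕ => c) := by
  refine ⟨.const c, fun _ => 3, .const 3, fun addr d h => ⟨.setNat (.const d) (.const c),
    fun s => (ends_setNat _ _ _).mono (by simp [NatExpr.cost]) ?_⟩⟩
  rintro _ rfl
  refine ⟨by simp [NatExpr.eval], fun i hi => ?_, rfl⟩
  simp [NatExpr.eval, Function.update_of_ne hi.ne]

/-- The values go into consecutive cells, in order. A program leaves all cells before its target
alone, so neither the arguments nor the values already computed are lost; everything beyond the
target is free workspace. -/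
theorem computeAll : ∀ {k : ℕ} {g : Fin k → (Fin j → ℕ) → ℕ}, (∀ i, PolyTime F (g i)) →
    ∃ τ : (Fin j → ℕ) → ℕ, PolyBdd τ ∧ ∀ (addr : Fin j → ℕ) (d : ℕ), (∀ i, addr i < d) →
      ∃ p : Program F, ∀ s : State F, Ends p s (τ fun i => s.nat (addr i)) (fun s' =>
        (∀ i : Fin k, s'.nat (d + i) = g i (fun i => s.nat (addr i))) ∧
          (∀ i < d, s'.nat i = s.nat i) ∧ s'.field = s.field)
  | 0, g, _ => ⟨fun _ => 1, .const 1, fun addr d _ => ⟨.skip, fun s =>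
      ⟨1, s, .skip s, le_rfl, fun i => i.elim0, fun _ _ => rfl, rfl⟩⟩⟩
  | k + 1, g, hg => by
    obtain ⟨τ, hτ, H⟩ := computeAll (g := fun i : Fin k => g i.castSucc) fun i => hg _
    obtain ⟨-, τ', hτ', H'⟩ := hg (Fin.last k)
    refine ⟨_, hτ.add hτ', fun addr d h => ?_⟩
    obtain ⟨p, hp⟩ := H addr d h
    obtain ⟨p', hp'⟩ := H' addr (d + k) fun i => (h i).trans_le (by omega)
    refine ⟨.seq p p', fun s => Ends.seq (hp s) ?_⟩
    rintro s' ⟨h1, h2, h3⟩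
    have h4 : (fun i => s'.nat (addr i)) = fun i => s.nat (addr i) :=
      funext fun i => h2 _ (h i)
    refine (h4 ▸ hp' s').mono le_rfl ?_
    rintro s'' ⟨h5, h6, h7⟩
    refine ⟨fun i => ?_, fun i hi => ?_, h7.trans h3⟩
    · refine Fin.lastCases ?_ (fun i => ?_) i
      · simpa using h5
      · rw [Fin.val_castSucc, h6 _ (by omega), ← h1]
    · rw [h6 _ (by omega), h2 _ hi]

theorem comp {k : ℕ} {f : (Fin k → ℕ) → ℕ} {g : Fin k → (Fin j → ℕ) → ℕ}
    (hf : PolyTime F f) (hg : ∀ i, PolyTime F (g i)) :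
    PolyTime F (fun v => f (fun i => g i v)) := by
  obtain ⟨τ, hτ, H⟩ := computeAll hg
  obtain ⟨hf0, τ', hτ', H'⟩ := hf
  refine ⟨hf0.comp fun i => (hg i).1, _, (hτ.add (hτ'.comp fun i => (hg i).1)).add (.const 4),
    fun addr d h => ?_⟩
  obtain ⟨p, hp⟩ := H addr d h
  obtain ⟨p', hp'⟩ := H' (fun i => d + i) (d + k) fun i => by simp
  refine ⟨.seq (.seq p p') (.setNat (.const d) (.load (.const (d + k)))), fun s => ?_⟩
  refine Ends.seq (R := fun s' => s'.nat (d + k) = f (fun i => g i fun i => s.nat (addr i)) ∧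
    (∀ i < d, s'.nat i = s.nat i) ∧ s'.field = s.field) (Ends.seq (hp s) ?_) ?_
  · rintro s' ⟨h1, h2, h3⟩
    have h4 : (fun i : Fin k => s'.nat (d + i)) = fun i => g i fun i => s.nat (addr i) :=
      funext h1
    refine (h4 ▸ hp' s').mono le_rfl ?_
    rintro s'' ⟨h5, h6, h7⟩
    exact ⟨h5, fun i hi => by rw [h6 _ (by omega), h2 _ hi], h7.trans h3⟩
  · rintro s' ⟨h1, h2, h3⟩
    refine (ends_setNat _ _ _).mono (by simp [NatExpr.cost]) ?_
    rintro _ rfl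
    refine ⟨by simpa [NatExpr.eval] using h1, fun i hi => ?_, h3⟩
    simp [NatExpr.eval, Function.update_of_ne hi.ne, h2 i hi]

theorem add : PolyTime F (fun v : Fin 2 → ℕ => v 0 + v 1) := by
  refine ⟨(PolyBdd.proj 0).add (.proj 1), fun _ => 7, .const 7, fun addr d h =>
    ⟨.setNat (.const d) (.add (.load (.const (addr 0))) (.load (.const (addr 1)))),
    fun s => (ends_setNat _ _ _).mono (by simp [NatExpr.cost]) ?_⟩⟩
  rintro _ rfl
  refine ⟨by simp [NatExpr.eval], fun i hi => ?_, rfl⟩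
  simp [NatExpr.eval, Function.update_of_ne hi.ne]

theorem sub : PolyTime F (fun v : Fin 2 → ℕ => v 0 - v 1) := by
  refine ⟨(PolyBdd.proj 0).mono fun v => Nat.sub_le _ _, fun _ => 7, .const 7, fun addr d h =>
    ⟨.setNat (.const d) (.sub (.load (.const (addr 0))) (.load (.const (addr 1)))),
    fun s => (ends_setNat _ _ _).mono (by simp [NatExpr.cost]) ?_⟩⟩
  rintro _ rfl
  refine ⟨by simp [NatExpr.eval], fun i hi => ?_, rfl⟩
  simp [NatExpr.eval, Function.update_of_ne hi.ne]

/-- Primitive recursion with polynomially bounded values. -/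
theorem natRec {base cnt : (Fin j → ℕ) → ℕ} {step : ℕ → ℕ → (Fin j → ℕ) → ℕ}
    (hb : PolyTime F base) (hc : PolyTime F cnt)
    (hs : PolyTime F (fun w : Fin (j + 2) → ℕ => step (w 0) (w 1) fun i => w i.succ.succ))
    {bd : (Fin j → ℕ) → ℕ} (hbd : PolyBdd bd)
    (hle : ∀ v, ∀ i ≤ cnt v,
      Nat.rec (motive := fun _ => ℕ) (base v) (fun i r => step i r v) i ≤ bd v) :
    PolyTime F (fun v =>
      Nat.rec (motive := fun _ => ℕ) (base v) (fun i r => step i r v) (cnt v)) := by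
  obtain ⟨-, τb, hτb, Hb⟩ := hb
  obtain ⟨hc0, τc, hτc, Hc⟩ := hc
  obtain ⟨-, τs, ⟨e, he⟩, Hs⟩ := hs
  refine ⟨hbd.mono fun v => hle v _ le_rfl,
    fun v => τc v + τb v + 4 + 3 + (cnt v * ((cnt v + bd v + ∑ i, v i + 2) ^ e + 4 + 6 + 5 + 1) + 5 + 1),
    ?_, fun addr d h => ?_⟩
  · exact (((hτc.add hτb).add (.const 4)).add (.const 3)).add
      (((hc0.mul ((((((((hc0.add hbd).add polyBdd_sum_args).add (.const 2)).pow e).add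
        (.const 4)).add (.const 6)).add (.const 5)).add (.const 1))).add (.const 5)).add (.const 1))
  -- Cell `d` holds the accumulator, `d + 1` the number of rounds, `d + 2` the round counter; the
  -- base value and each new value are computed at `d + 3` and then copied to `d`.
  obtain ⟨pc, hpc⟩ := Hc addr (d + 1) fun i => (h i).trans (by omega)
  obtain ⟨pb, hpb⟩ := Hb addr (d + 3) fun i => (h i).trans (by omega)
  obtain ⟨ps, hps⟩ := Hs (Matrix.vecCons (d + 2) (Matrix.vecCons d addr)) (d + 3) (by
    intro i
    refine Fin.cases (by simp) (fun i => Fin.cases (by simp) (fun i => ?_) i) i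
    simpa using (h i).trans (by omega))
  refine ⟨.seq (.seq (.seq (.seq pc pb) (.setNat (.const d) (.load (.const (d + 3)))))
      (.setNat (.const (d + 2)) (.const 0)))
    (.whileNat (.sub (.load (.const (d + 1))) (.load (.const (d + 2))))
      (.seq (.seq ps (.setNat (.const d) (.load (.const (d + 3)))))
        (.setNat (.const (d + 2)) (.add (.load (.const (d + 2))) (.const 1))))), fun s => ?_⟩
  generalize hv : (fun i => s.nat (addr i)) = v
  let I : ℕ → State F → Prop := fun k s' =>
    s'.nat d = Nat.rec (motive := fun _ => ℕ) (base v) (fun i r => step i r v) k ∧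
    s'.nat (d + 1) = cnt v ∧ s'.nat (d + 2) = k ∧ (∀ i < d, s'.nat i = s.nat i) ∧
    s'.field = s.field
  have hI0 : Ends (.seq (.seq (.seq pc pb) (.setNat (.const d) (.load (.const (d + 3)))))
      (.setNat (.const (d + 2)) (.const 0))) s (τc v + τb v + 4 + 3) (I 0) := by
    refine Ends.seq (R := fun s' => s'.nat d = base v ∧
        s'.nat (d + 1) = cnt v ∧ (∀ i < d, s'.nat i = s.nat i) ∧ s'.field = s.field)
      (Ends.seq (R := fun s' => s'.nat (d + 3) = base v ∧
        s'.nat (d + 1) = cnt v ∧ (∀ i < d, s'.nat i = s.nat i) ∧ s'.field = s.field)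
      (Ends.seq (hv ▸ hpc s) ?_) ?_) ?_
    · rintro s' ⟨h1, h2, h3⟩
      have h4 : (fun i => s'.nat (addr i)) = v :=
        hv ▸ funext fun i => h2 _ ((h i).trans (by omega))
      refine (h4 ▸ hpb s').mono le_rfl ?_
      rintro s'' ⟨h5, h6, h7⟩
      refine ⟨h5, ?_, fun i hi => ?_, h7.trans h3⟩
      · rw [h6 _ (by omega), h1]
      · rw [h6 _ (by omega), h2 _ (by omega)]
    · rintro s' ⟨h1, h2, h3, h4⟩
      refine (ends_setNat _ _ _).mono (by simp [NatExpr.cost]) ?_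
      rintro _ rfl
      refine ⟨by simpa [NatExpr.eval] using h1, ?_, fun i hi => ?_, h4⟩
      · simp [NatExpr.eval, h2]
      · simp [NatExpr.eval, Function.update_of_ne hi.ne, h3 i hi]
    · rintro s' ⟨h1, h2, h3, h4⟩
      refine (ends_setNat _ _ _).mono (by simp [NatExpr.cost]) ?_
      rintro _ rfl
      refine ⟨by simpa [NatExpr.eval] using h1, ?_, ?_, fun i hi => ?_, h4⟩
      · simp [NatExpr.eval, h2]
      · simp [NatExpr.eval]
      · have : i ≠ d + 2 := by omega
        simp [NatExpr.eval, Function.update_of_ne this, h3 i hi]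
  refine hI0.seq fun s0 hs0 => (ends_while I (cnt v)
    ((cnt v + bd v + ∑ i, v i + 2) ^ e + 4 + 6) ?_ ?_ hs0).mono (by simp [NatExpr.cost]) ?_
  · rintro i hi s' ⟨h1, h2, h3, h4, h5⟩
    refine ⟨by simp [NatExpr.eval, h2, h3]; omega, ?_⟩
    have h6 : (fun i : Fin j => s'.nat (addr i)) = v := hv ▸ funext fun i => h4 _ (h i)
    refine Ends.seq (τ₂ := 6) (R := fun s'' => s''.nat d = step i (s'.nat d) v ∧
        s''.nat (d + 1) = cnt v ∧ s''.nat (d + 2) = i ∧ (∀ i < d, s''.nat i = s.nat i) ∧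
        s''.field = s.field)
      (Ends.seq (τ₂ := 4) ((hps s').mono ?_ fun _ h => h) ?_) ?_
    · refine (he _).trans (Nat.pow_le_pow_left ?_ _)
      have h8 := hle v i hi.le
      have h9 : ∑ i : Fin j, s'.nat (addr i) = ∑ i, v i := by simp only [← h6]
      rw [Fin.sum_univ_succ, Fin.sum_univ_succ]
      simp only [Matrix.cons_val_zero, Matrix.cons_val_succ, h3, h1, h9]
      omega
    · rintro s'' ⟨h7, h8, h9⟩
      refine (ends_setNat _ _ _).mono (by simp [NatExpr.cost]) ?_
      rintro _ rfl
      refine ⟨?_, ?_, ?_, fun i hi => ?_, h9.trans h5⟩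
      · simp [NatExpr.eval, h7, h3, ← h6]
      · simp [NatExpr.eval, h8, h2]
      · simp [NatExpr.eval, h8, h3]
      · simp [NatExpr.eval, Function.update_of_ne hi.ne, h8 i (by omega), h4 i hi]
    · rintro s'' ⟨h7, h8, h9, h10, h11⟩
      refine (ends_setNat _ _ _).mono (by simp [NatExpr.cost]) ?_
      rintro _ rfl
      refine ⟨?_, ?_, ?_, fun i hi => ?_, h11⟩
      · simp [NatExpr.eval, h7, h1]
      · simp [NatExpr.eval, h8]
      · simp [NatExpr.eval, h9]
      · have : i ≠ d + 2 := by omega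
        simp [NatExpr.eval, Function.update_of_ne this, h10 i hi]
  · rintro s' ⟨h1, h2, h3, h4, h5⟩
    simp [NatExpr.eval, h2, h3]
  · rintro s' ⟨h1, h2, h3, h4, h5⟩
    exact ⟨h1, h4, h5⟩

end PolyTime
end
end RAM

/-! ### Bounded search, decidable relations and arithmetic in polynomial time. -/

namespace RAM

/-- The least `x < B` with `R x`, or `B` if there is none. -/
noncomputable def leastBelow (B : ℕ) (R : ℕ → Prop) : ℕ := by
  -- The accumulator is itself the candidate: it grows until `R` holds and then stays. This is a
  -- primitive recursion with values at most `B`, as `PolyTime.natRec` requires.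
  classical exact Nat.rec (motive := fun _ => ℕ) 0 (fun _ r => if R r then r else r + 1) B

theorem leastBelow_spec (B : ℕ) (R : ℕ → Prop) :
    leastBelow B R ≤ B ∧ (∀ y < leastBelow B R, ¬ R y) ∧
      (leastBelow B R < B → R (leastBelow B R)) := by
  classical
  induction B with
  | zero => exact ⟨le_rfl, fun y hy => absurd hy (Nat.not_lt_zero _), fun h => absurd h (lt_irrefl _)⟩
  | succ B ih =>
    have h : leastBelow (B + 1) R = if R (leastBelow B R) then leastBelow B R
      else leastBelow B R + 1 := rfl
    obtain ⟨h1, h2, h3⟩ := ih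
    rw [h]
    split_ifs with h4
    · exact ⟨h1.trans (Nat.le_succ _), h2, fun _ => h4⟩
    · have h5 : leastBelow B R = B := by
        by_contra h5
        exact h4 (h3 (lt_of_le_of_ne h1 h5))
      refine ⟨by omega, fun y hy => ?_, fun h => by omega⟩
      rcases Nat.lt_succ_iff_lt_or_eq.mp hy with h | rfl
      exacts [h2 y h, h4]

theorem leastBelow_lt_iff {B : ℕ} {R : ℕ → Prop} : leastBelow B R < B ↔ ∃ x < B, R x := by
  obtain ⟨h1, h2, h3⟩ := leastBelow_spec B R
  refine ⟨fun h => ⟨_, h, h3 h⟩, fun ⟨x, hx, hR⟩ => ?_⟩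
  by_contra h
  exact h2 x (by omega) hR

theorem leastBelow_eq {B x : ℕ} {R : ℕ → Prop} (hx : x < B) (hR : R x) (h : ∀ y < x, ¬ R y) :
    leastBelow B R = x := by
  obtain ⟨-, h2, h3⟩ := leastBelow_spec B R
  have h4 : leastBelow B R < B := leastBelow_lt_iff.mpr ⟨x, hx, hR⟩
  rcases lt_trichotomy (leastBelow B R) x with h5 | h5 | h5
  · exact absurd (h3 h4) (h _ h5)
  · exact h5
  · exact absurd hR (h2 _ h5)

section
variable (F : Type*) [Field F] {j : ℕ}

/-- `PolyTime` for functions of one argument. -/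
def PolyTime₁ (f : ℕ → ℕ) : Prop := PolyTime F (fun v : Fin 1 → ℕ => f (v 0))
/-- `PolyTime` for functions of two arguments. -/
def PolyTime₂ (f : ℕ → ℕ → ℕ) : Prop := PolyTime F (fun v : Fin 2 → ℕ => f (v 0) (v 1))
/-- `PolyTime` for functions of three arguments. -/
def PolyTime₃ (f : ℕ → ℕ → ℕ → ℕ) : Prop :=
  PolyTime F (fun v : Fin 3 → ℕ => f (v 0) (v 1) (v 2))
/-- `PolyTime` for functions of four arguments. -/
def PolyTime₄ (f : ℕ → ℕ → ℕ → ℕ → ℕ) : Prop :=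
  PolyTime F (fun v : Fin 4 → ℕ => f (v 0) (v 1) (v 2) (v 3))
/-- `PolyTime` for functions of five arguments. -/
def PolyTime₅ (f : ℕ → ℕ → ℕ → ℕ → ℕ → ℕ) : Prop :=
  PolyTime F (fun v : Fin 5 → ℕ => f (v 0) (v 1) (v 2) (v 3) (v 4))

open Classical in
/-- The relation `R` is decided in polynomial time. -/
def PolyDec (R : (Fin j → ℕ) → Prop) : Prop := PolyTime F (fun v => if R v then 1 else 0)

variable {F}

theorem PolyTime₁.comp {f : ℕ → ℕ} (hf : PolyTime₁ F f) {a : (Fin j → ℕ) → ℕ}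
    (ha : PolyTime F a) : PolyTime F (fun v => f (a v)) :=
  PolyTime.comp (g := ![a]) hf (by simpa [Fin.forall_fin_succ])

theorem PolyTime₂.comp {f : ℕ → ℕ → ℕ} (hf : PolyTime₂ F f) {a b : (Fin j → ℕ) → ℕ}
    (ha : PolyTime F a) (hb : PolyTime F b) : PolyTime F (fun v => f (a v) (b v)) :=
  PolyTime.comp (g := ![a, b]) hf (by simp [Fin.forall_fin_succ, *])

theorem PolyTime₃.comp {f : ℕ → ℕ → ℕ → ℕ} (hf : PolyTime₃ F f) {a b c : (Fin j → ℕ) → ℕ}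
    (ha : PolyTime F a) (hb : PolyTime F b) (hc : PolyTime F c) :
    PolyTime F (fun v => f (a v) (b v) (c v)) :=
  PolyTime.comp (g := ![a, b, c]) hf (by simp [Fin.forall_fin_succ, *])

theorem PolyTime₄.comp {f : ℕ → ℕ → ℕ → ℕ → ℕ} (hf : PolyTime₄ F f)
    {a b c d : (Fin j → ℕ) → ℕ} (ha : PolyTime F a) (hb : PolyTime F b) (hc : PolyTime F c)
    (hd : PolyTime F d) : PolyTime F (fun v => f (a v) (b v) (c v) (d v)) :=
  PolyTime.comp (g := ![a, b, c, d]) hf (by simp [Fin.forall_fin_succ, *])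

theorem PolyTime₅.comp {f : ℕ → ℕ → ℕ → ℕ → ℕ → ℕ} (hf : PolyTime₅ F f)
    {a b c d e : (Fin j → ℕ) → ℕ} (ha : PolyTime F a) (hb : PolyTime F b) (hc : PolyTime F c)
    (hd : PolyTime F d) (he : PolyTime F e) :
    PolyTime F (fun v => f (a v) (b v) (c v) (d v) (e v)) :=
  PolyTime.comp (g := ![a, b, c, d, e]) hf (by simp [Fin.forall_fin_succ, *])

theorem polyTime₂_add : PolyTime₂ F (fun x y => x + y) := PolyTime.add
theorem polyTime₂_sub : PolyTime₂ F (fun x y => x - y) := PolyTime.sub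

/-- Repeated addition; the running time is polynomial in the value of the factors, not in their
length, which is all that `PolyTime` asks. -/
theorem polyTime₂_mul : PolyTime₂ F (fun x y => x * y) := by
  have h : ∀ (v : Fin 2 → ℕ) (i : ℕ),
      Nat.rec (motive := fun _ => ℕ) 0 (fun _ r => r + v 0) i = v 0 * i := by
    intro v i
    induction i with
    | zero => rfl
    | succ i ih => rw [mul_add, mul_one, ← ih]
  have := PolyTime.natRec (F := F) (j := 2) (base := fun _ => 0) (cnt := fun v => v 1)
    (step := fun _ r v => r + v 0) (.const 0) (.proj 1)
    (polyTime₂_add.comp (.proj 1) (.proj _)) (bd := fun v => v 0 * v 1)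
    ((PolyBdd.proj 0).mul (.proj 1)) (fun v i hi => by rw [h]; exact Nat.mul_le_mul_left _ hi)
  simpa only [h] using! this

namespace PolyDec

theorem of_iff {R S : (Fin j → ℕ) → Prop} (h : PolyDec F R) (hRS : ∀ v, S v ↔ R v) :
    PolyDec F S := by
  rwa [show S = R from funext fun v => propext (hRS v)]

theorem le {a b : (Fin j → ℕ) → ℕ} (ha : PolyTime F a) (hb : PolyTime F b) :
    PolyDec F (fun v => a v ≤ b v) := by
  have := polyTime₂_sub.comp (.const 1) (polyTime₂_sub.comp ha hb)
  unfold PolyDec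
  convert this using 2 with v
  split_ifs <;> omega

theorem not {R : (Fin j → ℕ) → Prop} (hR : PolyDec F R) : PolyDec F (fun v => ¬ R v) := by
  have := polyTime₂_sub.comp (.const 1) hR
  unfold PolyDec
  convert this using 2 with v
  split_ifs <;> first | rfl | contradiction

theorem lt {a b : (Fin j → ℕ) → ℕ} (ha : PolyTime F a) (hb : PolyTime F b) :
    PolyDec F (fun v => a v < b v) :=
  (le hb ha).not.of_iff fun v => by omega

theorem and {R S : (Fin j → ℕ) → Prop} (hR : PolyDec F R) (hS : PolyDec F S) :
    PolyDec F (fun v => R v ∧ S v) := by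
  have := polyTime₂_mul.comp hR hS
  unfold PolyDec
  convert this using 2 with v
  split_ifs <;> first | rfl | tauto

theorem or {R S : (Fin j → ℕ) → Prop} (hR : PolyDec F R) (hS : PolyDec F S) :
    PolyDec F (fun v => R v ∨ S v) :=
  (hR.not.and hS.not).not.of_iff fun v => by tauto

theorem eq {a b : (Fin j → ℕ) → ℕ} (ha : PolyTime F a) (hb : PolyTime F b) :
    PolyDec F (fun v => a v = b v) :=
  ((le ha hb).and (le hb ha)).of_iff fun v => by omega

end PolyDec

theorem PolyTime.ite {R : (Fin j → ℕ) → Prop} [DecidablePred R] (hR : PolyDec F R) {a b : (Fin j → ℕ) → ℕ}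
    (ha : PolyTime F a) (hb : PolyTime F b) : PolyTime F (fun v => if R v then a v else b v) := by
  have := polyTime₂_add.comp (polyTime₂_mul.comp hR ha) (polyTime₂_mul.comp hR.not hb)
  convert this using 2 with v
  by_cases h : R v <;> simp [h]

theorem PolyTime.leastBelow {B : (Fin j → ℕ) → ℕ} {R : ℕ → (Fin j → ℕ) → Prop}
    (hB : PolyTime F B)
    (hR : PolyDec F (fun w : Fin (j + 1) → ℕ => R (w 0) fun i => w i.succ)) :
    PolyTime F (fun v => leastBelow (B v) fun x => R x v) := by
  classical
  refine PolyTime.natRec (bd := B) (step := fun _ r v => if R r v then r else r + 1) (.const 0) hB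
    (PolyTime.ite ?_ (.proj 1) (polyTime₂_add.comp (.proj 1) (.const 1))) hB.1
    fun v i hi => (leastBelow_spec i _).1.trans hi
  exact PolyTime.comp (g := fun i w => w i.succ) hR fun i => .proj _

theorem PolyDec.exists_lt {B : (Fin j → ℕ) → ℕ} {R : ℕ → (Fin j → ℕ) → Prop}
    (hB : PolyTime F B)
    (hR : PolyDec F (fun w : Fin (j + 1) → ℕ => R (w 0) fun i => w i.succ)) :
    PolyDec F (fun v => ∃ x < B v, R x v) :=
  (PolyDec.lt (PolyTime.leastBelow hB hR) hB).of_iff fun _ => leastBelow_lt_iff.symm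

theorem PolyDec.forall_lt {B : (Fin j → ℕ) → ℕ} {R : ℕ → (Fin j → ℕ) → Prop}
    (hB : PolyTime F B)
    (hR : PolyDec F (fun w : Fin (j + 1) → ℕ => R (w 0) fun i => w i.succ)) :
    PolyDec F (fun v => ∀ x < B v, R x v) :=
  (PolyDec.exists_lt (R := fun x v => ¬ R x v) hB hR.not).not.of_iff fun _ => by push Not; rfl

/-- A polynomially bounded function whose graph is decided in polynomial time. -/
theorem PolyTime.of_graph {f B : (Fin j → ℕ) → ℕ} {R : ℕ → (Fin j → ℕ) → Prop}
    (hB : PolyTime F B)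
    (hR : PolyDec F (fun w : Fin (j + 1) → ℕ => R (w 0) fun i => w i.succ))
    (hf : ∀ v, f v ≤ B v) (h : ∀ v, ∀ z ≤ B v, R z v ↔ z = f v) : PolyTime F f := by
  have := PolyTime.leastBelow (polyTime₂_add.comp hB (.const 1)) hR
  convert this using 2 with v
  exact (leastBelow_eq (Nat.lt_succ_of_le (hf v)) ((h v _ (hf v)).mpr rfl) fun y hy hy' =>
    hy.ne ((h v y (hy.le.trans (hf v))).mp hy')).symm

theorem polyTime₂_div : PolyTime₂ F (fun x y => x / y) := by
  refine PolyTime.of_graph (B := fun v => v 0)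
    -- The first alternative is the convention `x / 0 = 0`.
    (R := fun z v => (v 1 = 0 ∧ z = 0) ∨ (z * v 1 ≤ v 0 ∧ v 0 < (z + 1) * v 1)) (.proj 0)
    (((PolyDec.eq (.proj _) (.const 0)).and (PolyDec.eq (.proj _) (.const 0))).or
      ((PolyDec.le (polyTime₂_mul.comp (.proj _) (.proj _)) (.proj _)).and
        (PolyDec.lt (.proj _) (polyTime₂_mul.comp (polyTime₂_add.comp (.proj _) (.const 1))
          (.proj _)))))
    (fun v => Nat.div_le_self _ _) fun v z _ => ?_
  generalize v 0 = x
  rcases Nat.eq_zero_or_pos (v 1) with h | h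
  · simp [h]
  · change _ ↔ z = x / v 1
    rw [eq_comm (b := x / v 1), Nat.div_eq_iff h, Nat.lt_iff_le_pred (by positivity)]
    simp only [h.ne', false_and, false_or]
    rw [add_mul, one_mul]

theorem polyTime₂_mod : PolyTime₂ F (fun x y => x % y) := by
  have := polyTime₂_sub.comp (F := F) (j := 2) (.proj 0)
    (polyTime₂_mul.comp (.proj 1) (polyTime₂_div.comp (.proj 0) (.proj 1)))
  unfold PolyTime₂
  convert this using 2 with v
  exact Nat.mod_eq_sub_mul_div

theorem polyTime₁_pow (e : ℕ) : PolyTime₁ F (fun x => x ^ e) := by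
  induction e with
  | zero => simpa [PolyTime₁] using PolyTime.const 1
  | succ e ih => exact polyTime₂_mul.comp ih (.proj 0)

theorem polyTime₂_min : PolyTime₂ F (fun x y => min x y) := by
  have := PolyTime.ite (F := F) (j := 2) (PolyDec.le (.proj 0) (.proj 1)) (.proj 0) (.proj 1)
  unfold PolyTime₂
  convert this using 2 with v
  exact min_def _ _

/-- The power `x ^ i`, cut off at `B`. -/
theorem polyTime₃_min_pow : PolyTime₃ F (fun x i B => min (x ^ i) B) := by
  -- Cutting off after every multiplication gives the same as cutting off once at the end, and keeps
  -- all intermediate values polynomially bounded.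
  have h : ∀ (v : Fin 3 → ℕ) (i : ℕ), Nat.rec (motive := fun _ => ℕ) (min 1 (v 2))
      (fun _ r => min (v 0 * r) (v 2)) i = min (v 0 ^ i) (v 2) := by
    intro v i
    induction i with
    | zero => simp
    | succ i ih =>
      change min (v 0 * _) (v 2) = _
      rw [ih, pow_succ']
      generalize v 0 ^ i = x
      rcases Nat.eq_zero_or_pos (v 0) with h0 | h0
      · simp [h0]
      rcases le_total x (v 2) with h1 | h1
      · rw [min_eq_left h1]
      · rw [min_eq_right h1, min_eq_right (Nat.le_mul_of_pos_left _ h0),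
          min_eq_right (h1.trans (Nat.le_mul_of_pos_left _ h0))]
  have := PolyTime.natRec (F := F) (j := 3) (base := fun v => min 1 (v 2)) (cnt := fun v => v 1)
    (step := fun _ r v => min (v 0 * r) (v 2)) (polyTime₂_min.comp (.const 1) (.proj 2)) (.proj 1)
    (polyTime₂_min.comp (polyTime₂_mul.comp (.proj _) (.proj 1)) (.proj _))
    (bd := fun v => v 2) (.proj 2) (fun v i hi => by rw [h]; exact min_le_right _ _)
  simpa only [h] using! this

/-- Dividing by `b` again and again avoids forming `b ^ i`, which need not be polynomially bounded.
-/
theorem polyTime₃_div_pow : PolyTime₃ F (fun b x i => x / b ^ i) := by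
  have h : ∀ (v : Fin 3 → ℕ) (i : ℕ), Nat.rec (motive := fun _ => ℕ) (v 1)
      (fun _ r => r / v 0) i = v 1 / v 0 ^ i := by
    intro v i
    induction i with
    | zero => simp
    | succ i ih =>
      change _ / v 0 = _
      rw [ih, Nat.div_div_eq_div_mul, pow_succ]
  have := PolyTime.natRec (F := F) (j := 3) (base := fun v => v 1) (cnt := fun v => v 2)
    (step := fun _ r v => r / v 0) (.proj 1) (.proj 2)
    (polyTime₂_div.comp (.proj 1) (.proj _))
    (bd := fun v => v 1) (.proj 1) (fun v i hi => by rw [h]; exact Nat.div_le_self _ _)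
  simpa only [h] using! this

/-- The digit number `i` of `x` in base `b`. -/
def digit (b x i : ℕ) : ℕ := x / b ^ i % b

theorem polyTime₃_digit : PolyTime₃ F digit :=
  polyTime₂_mod.comp (polyTime₃_div_pow.comp (.proj 0) (.proj 1) (.proj 2)) (.proj 0)

theorem PolyTime.sum {ι : Type*} (s : Finset ι) {f : ι → (Fin j → ℕ) → ℕ}
    (hf : ∀ i ∈ s, PolyTime F (f i)) : PolyTime F (fun v => ∑ i ∈ s, f i v) := by
  classical
  induction s using Finset.induction_on with
  | empty => simpa using PolyTime.const 0
  | insert i s hi ih =>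
    simp only [Finset.sum_insert hi]
    exact polyTime₂_add.comp (hf i (by simp)) (ih fun k hk => hf k (by simp [hk]))

/-- A function of finite support is a finite table written into the program. This provides the
operations of `F` on codes and the precomputed matrices for small dimensions. -/
theorem polyTime₂_of_support {f : ℕ → ℕ → ℕ} (b : ℕ) (h : ∀ x y, f x y ≠ 0 → x < b ∧ y < b) :
    PolyTime₂ F f := by
  classical
  have := PolyTime.sum (F := F) (j := 2) (Finset.range b ×ˢ Finset.range b)
    (f := fun i v => if v 0 = i.1 ∧ v 1 = i.2 then f i.1 i.2 else 0) fun i _ =>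
    PolyTime.ite ((PolyDec.eq (.proj _) (.const _)).and (PolyDec.eq (.proj _) (.const _)))
      (.const _) (.const 0)
  unfold PolyTime₂
  convert this using 2 with v
  by_cases h0 : f (v 0) (v 1) = 0
  · rw [h0, eq_comm, Finset.sum_eq_zero]
    intro i _
    split_ifs with h1
    · rw [← h1.1, ← h1.2, h0]
    · rfl
  · rw [Finset.sum_eq_single (v 0, v 1)]
    · simp
    · intro i _ hi
      rw [if_neg]
      exact fun h1 => hi (Prod.ext h1.1.symm h1.2.symm)
    · intro h1
      simp [h _ _ h0] at h1

end
end RAM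

/-! ### The machine that writes a matrix of affine forms in the input. -/

namespace RAM

section
variable {F : Type*} [Field F]

/-- A program that translates a number `< q` to a field element. -/
theorem exists_setField_val (val : ℕ → F) (c : ℕ) (dst : NatExpr) (q : ℕ) :
    ∃ (p : Program F) (τ : ℕ), ∀ s : State F, s.nat c < q → Ends p s τ
      (fun s' => s' = { s with
        field := Function.update s.field (dst.eval s.nat) (val (s.nat c)) }) := by
  induction q with
  | zero => exact ⟨.skip, 0, fun s h => absurd h (Nat.not_lt_zero _)⟩
  | succ q ih =>
    obtain ⟨p, τ, hp⟩ := ih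
    refine ⟨.ifNat (.sub (.const q) (.load (.const c))) p (.setField dst (.const (val q))),
      5 + τ + (dst.cost + 2) + 1, fun s hs => ?_⟩
    by_cases h : s.nat c < q
    · obtain ⟨T, s', h1, h2, h3⟩ := hp s h
      refine ⟨_, s', .ifNat_true ?_ h1, ?_, h3⟩
      · simp [NatExpr.eval]; omega
      · simp [NatExpr.cost]; omega
    · obtain rfl : s.nat c = q := by omega
      refine ⟨_, _, .ifNat_false ?_ (.setField _ _ _), ?_, rfl⟩
      · simp [NatExpr.eval]
      · simp [NatExpr.cost, FieldExpr.cost]; omega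

theorem inputState_field {m n : ℕ} (M : Matrix (Fin m) (Fin n) F) (i : Fin m) (j : Fin n) :
    (inputState M).field ((i : ℕ) * n + j) = M i j := by
  have h : (i : ℕ) * n + j = (finProdFinEquiv (i, j) : Fin (m * n)) := by
    simp [finProdFinEquiv]; ring
  have h' : (i : ℕ) * n + j < m * n := h ▸ Fin.is_lt _
  simp only [inputState, h', dif_pos]
  have : (⟨(i : ℕ) * n + j, h'⟩ : Fin (m * n)) = finProdFinEquiv (i, j) := Fin.ext h
  rw [this, Equiv.symm_apply_apply]

/-- A machine that outputs a matrix with entries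
`val (W m n i) + ∑ a < m, val (E m n i a) * x (pos m n i a)`, `x` being the input. -/
theorem exists_program {N : ℕ → ℕ → ℕ} {W : ℕ → ℕ → ℕ → ℕ} {E pos : ℕ → ℕ → ℕ → ℕ → ℕ}
    (hN : PolyTime₂ F N) (hW : PolyTime₃ F W) (hE : PolyTime₄ F E) (hpos : PolyTime₄ F pos)
    (val : ℕ → F) (q : ℕ) (hWq : ∀ m n i, W m n i < q) (hEq : ∀ m n i a, E m n i a < q) :
    ∃ (alg : Program F) (e : ℕ), ∀ (m n : ℕ) (M : Matrix (Fin m) (Fin n) F),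
      (∀ i < N m n * N m n, ∀ a < m, pos m n i a < m * n) →
      Ends alg (inputState M) ((m + n + 2) ^ e) fun s =>
        s.nat 0 = N m n ∧ ∀ i < N m n * N m n, s.field i = val (W m n i) +
          ∑ a ∈ Finset.range m, val (E m n i a) * (inputState M).field (pos m n i a) := by
  have hNN := polyTime₂_mul.comp hN hN
  have hmn := polyTime₂_mul (F := F)
  have hD := polyTime₂_add.comp hNN hmn
  have hA := polyTime₂_add.comp hD hmn
  obtain ⟨τ₀, hτ₀, H₀⟩ := PolyTime.computeAll (g := ![_, _, _, _, _]) (by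
    rw [Fin.forall_fin_succ, Fin.forall_fin_succ, Fin.forall_fin_succ, Fin.forall_fin_succ,
      Fin.forall_fin_one]
    exact ⟨hN, hNN, hD, hA, hmn⟩)
  obtain ⟨-, τW, ⟨eW, hτW⟩, HW⟩ := hW
  obtain ⟨-, τE, ⟨eE, hτE⟩, HE⟩ := hE
  obtain ⟨-, τp, ⟨ep, hτp⟩, Hp⟩ := hpos
  -- Number memory: `m`, `n`, `N`, `N²`, `N² + mn`, `N² + 2mn`, `mn` in cells `0` to `6`, the loop
  -- counters in `7` and `8`, values of `W`, `E` and `pos` in `9` and `10`, workspace beyond.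
  obtain ⟨p₀, hp₀⟩ := H₀ ![0, 1] 2 (by simp [Fin.forall_fin_succ])
  obtain ⟨pW, hpW⟩ := HW ![0, 1, 7] 9 (by simp [Fin.forall_fin_succ])
  obtain ⟨pE, hpE⟩ := HE ![0, 1, 7, 8] 9 (by simp [Fin.forall_fin_succ])
  obtain ⟨pp, hpp⟩ := Hp ![0, 1, 7, 8] 10 (by simp [Fin.forall_fin_succ])
  obtain ⟨pv, τv, hpv⟩ := exists_setField_val val 9 (.load (.const 5)) q
  obtain ⟨pv', τv', hpv'⟩ := exists_setField_val val 9 (.add (.load (.const 5)) (.const 1)) q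
  let inc (c : ℕ) : Program F := .setNat (.const c) (.add (.load (.const c)) (.const 1))
  let zero (c : ℕ) : Program F := .setNat (.const c) (.const 0)
  -- Field memory: the input is copied to the `mn` cells from `N² + mn` on, which meet neither the
  -- input nor the `N²` output cells. Cell `N² + 2mn` accumulates the current entry, and the next
  -- cell holds the current coefficient.
  let copyBody : Program F :=
    .seq (.setField (.add (.load (.const 4)) (.load (.const 7))) (.load (.load (.const 7)))) (inc 7)
  let innerBody : Program F :=
    .seq (.seq (.seq (.seq pE pp) pv')
      (.setField (.load (.const 5)) (.add (.load (.load (.const 5)))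
        (.mul (.load (.add (.load (.const 5)) (.const 1)))
          (.load (.add (.load (.const 4)) (.load (.const 10)))))))) (inc 8)
  let outerBody : Program F :=
    .seq (.seq (.seq (.seq (.seq pW pv) (zero 8))
      (.whileNat (.sub (.load (.const 0)) (.load (.const 8))) innerBody))
      (.setField (.load (.const 7)) (.load (.load (.const 5))))) (inc 7)
  let R : (Fin 2 → ℕ) → ℕ := fun v => N (v 0) (v 1) * N (v 0) (v 1)
  -- Inside the loops the counters are at most `R v` and `v 0`, so `S v` bounds the sum of the
  -- arguments in every call of a subroutine, plus the `2` of `PolyBdd`.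
  let S : (Fin 2 → ℕ) → ℕ := fun v => ∑ i, v i + R v + v 0 + 2
  let cIn : (Fin 2 → ℕ) → ℕ := fun v => S v ^ eE + S v ^ ep + (τv' + 20) + 6
  let cOut : (Fin 2 → ℕ) → ℕ := fun v =>
    S v ^ eW + (τv + 3) + (v 0 * (cIn v + 6) + 6) + 6 + 6
  let cost : (Fin 2 → ℕ) → ℕ := fun v =>
    τ₀ v + 3 + (v 0 * v 1 * (15 + 6) + 6) + 3 + (R v * (cOut v + 6) + 6) + 4
  have hcost : PolyBdd cost := by
    have hR : PolyBdd R := hNN.1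
    have hS : PolyBdd S := ((polyBdd_sum_args.add hR).add (.proj 0)).add (.const 2)
    have hcIn : PolyBdd cIn := (((hS.pow _).add (hS.pow _)).add (.const _)).add (.const _)
    have hcOut : PolyBdd cOut := ((((hS.pow _).add (.const _)).add
      (((PolyBdd.proj 0).mul (hcIn.add (.const _))).add (.const _))).add (.const _)).add (.const _)
    exact ((((hτ₀.add (.const _)).add ((((PolyBdd.proj 0).mul (.proj 1)).mul (.const _)).add
      (.const _))).add (.const _)).add ((hR.mul (hcOut.add (.const _))).add (.const _))).add
      (.const _)
  obtain ⟨e, he⟩ := hcost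
  refine ⟨.seq (.seq (.seq (.seq (.seq p₀ (zero 7))
    (.whileNat (.sub (.load (.const 6)) (.load (.const 7))) copyBody)) (zero 7))
    (.whileNat (.sub (.load (.const 3)) (.load (.const 7))) outerBody))
    (.setNat (.const 0) (.load (.const 2))), e, fun m n M hlt => ?_⟩
  set x := (inputState M).field with hx
  set NN := N m n * N m n with hNNdef
  have hsum : ∑ i, ![m, n] i = m + n := by simp
  have hS : S ![m, n] = m + n + NN + m + 2 := by simp only [S, hsum]; rfl
  refine Ends.mono (τ := cost ![m, n]) ?_ (by simpa using he ![m, n]) fun _ h => h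
  let Base : State F → Prop := fun s => s.nat 0 = m ∧ s.nat 1 = n ∧ s.nat 2 = N m n ∧
      s.nat 3 = NN ∧ s.nat 4 = NN + m * n ∧ s.nat 5 = NN + m * n + m * n ∧ s.nat 6 = m * n
  have base_congr : ∀ {s s' : State F}, Base s → (∀ i < 7, s'.nat i = s.nat i) → Base s' := by
    intro s s' h h'
    obtain ⟨h0, h1, h2, h3, h4, h5, h6⟩ := h
    exact ⟨(h' 0 (by omega)).trans h0, (h' 1 (by omega)).trans h1, (h' 2 (by omega)).trans h2,
      (h' 3 (by omega)).trans h3, (h' 4 (by omega)).trans h4, (h' 5 (by omega)).trans h5,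
      (h' 6 (by omega)).trans h6⟩
  have inc_ends : ∀ (c : ℕ) (s : State F), Ends (inc c) s 6 fun s' =>
      s'.nat c = s.nat c + 1 ∧ (∀ i ≠ c, s'.nat i = s.nat i) ∧ s'.field = s.field := by
    intro c s
    refine (ends_setNat _ _ _).mono (by simp [NatExpr.cost]) ?_
    rintro _ rfl
    exact ⟨by simp [NatExpr.eval], fun i hi => by simp [NatExpr.eval, hi], rfl⟩
  have zero_ends : ∀ (c : ℕ) (s : State F), Ends (zero c) s 3 fun s' =>
      s'.nat c = 0 ∧ (∀ i ≠ c, s'.nat i = s.nat i) ∧ s'.field = s.field := by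
    intro c s
    refine (ends_setNat _ _ _).mono (by simp [NatExpr.cost]) ?_
    rintro _ rfl
    exact ⟨by simp [NatExpr.eval], fun i hi => by simp [NatExpr.eval, hi], rfl⟩
  let Copied : State F → Prop := fun s => ∀ i < m * n, s.field (NN + m * n + i) = x i
  let out : ℕ → F := fun i =>
    val (W m n i) + ∑ a ∈ Finset.range m, val (E m n i a) * x (pos m n i a)
  let I : ℕ → State F → Prop := fun k s => Base s ∧ s.nat 7 = k ∧
    (∀ i < m * n, s.field i = x i) ∧ ∀ i < k, s.field (NN + m * n + i) = x i
  let J : ℕ → State F → Prop := fun k s => Base s ∧ s.nat 7 = k ∧ Copied s ∧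
    ∀ i < k, s.field i = out i
  let K : ℕ → ℕ → State F → Prop := fun k a s => Base s ∧ s.nat 7 = k ∧ s.nat 8 = a ∧ Copied s ∧
    (∀ i < k, s.field i = out i) ∧ s.field (NN + m * n + m * n) =
      val (W m n k) + ∑ b ∈ Finset.range a, val (E m n k b) * x (pos m n k b)
  have inner : ∀ k < NN, ∀ a < m, ∀ s, K k a s →
      Ends innerBody s (cIn ![m, n]) (K k (a + 1)) := by
    rintro k hk a ha s ⟨hB, h7, h8, hC, ho, hacc⟩
    have hSle : ∑ i, s.nat (![0, 1, 7, 8] i) + 2 ≤ S ![m, n] := by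
      rw [hS, Fin.sum_univ_four]
      change s.nat 0 + s.nat 1 + s.nat 7 + s.nat 8 + 2 ≤ _
      have := hB.1
      have := hB.2.1
      omega
    have e1 : Ends pE s (S ![m, n] ^ eE) fun s' =>
        s'.nat 9 = E m n k a ∧ (∀ i < 9, s'.nat i = s.nat i) ∧ s'.field = s.field := by
      refine (hpE s).mono ((hτE _).trans (Nat.pow_le_pow_left hSle _)) ?_
      rintro s' ⟨g1, g2, g3⟩
      refine ⟨?_, g2, g3⟩
      rw [← hB.1, ← hB.2.1, ← h7, ← h8]
      exact g1
    have e2 : Ends (.seq pE pp) s (S ![m, n] ^ eE + S ![m, n] ^ ep) fun s' =>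
        s'.nat 9 = E m n k a ∧ s'.nat 10 = pos m n k a ∧ (∀ i < 9, s'.nat i = s.nat i) ∧
          s'.field = s.field := by
      refine e1.seq ?_
      rintro s' ⟨g1, g2, g3⟩
      have hSle' : ∑ i, s'.nat (![0, 1, 7, 8] i) + 2 ≤ S ![m, n] := by
        refine le_trans (le_of_eq ?_) hSle
        rw [Fin.sum_univ_four, Fin.sum_univ_four]
        change s'.nat 0 + s'.nat 1 + s'.nat 7 + s'.nat 8 + 2 =
          s.nat 0 + s.nat 1 + s.nat 7 + s.nat 8 + 2
        rw [g2 0 (by omega), g2 1 (by omega), g2 7 (by omega), g2 8 (by omega)]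
      refine (hpp s').mono ((hτp _).trans (Nat.pow_le_pow_left hSle' _)) ?_
      rintro s'' ⟨g4, g5, g6⟩
      refine ⟨by rw [g5 9 (by omega), g1], ?_, fun i hi => by rw [g5 i (by omega), g2 i hi],
        g6.trans g3⟩
      rw [← hB.1, ← hB.2.1, ← h7, ← h8, ← g2 0 (by omega), ← g2 1 (by omega), ← g2 7 (by omega),
        ← g2 8 (by omega)]
      exact g4
    refine Ends.mono (τ := S ![m, n] ^ eE + S ![m, n] ^ ep + τv' + 20 + 6)
      (Ends.seq (R := fun s' => Base s' ∧ s'.nat 7 = k ∧ s'.nat 8 = a ∧ Copied s' ∧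
        (∀ i < k, s'.field i = out i) ∧ s'.field (NN + m * n + m * n) =
          val (W m n k) + ∑ b ∈ Finset.range (a + 1), val (E m n k b) * x (pos m n k b))
        (Ends.seq (R := fun s' => Base s' ∧ s'.nat 7 = k ∧ s'.nat 8 = a ∧ s'.nat 10 = pos m n k a ∧
          s'.field = Function.update s.field (NN + m * n + m * n + 1) (val (E m n k a)))
          (e2.seq ?_) ?_) ?_) (by simp only [cIn]; omega) fun _ h => h
    · rintro s' ⟨g1, g2, g3, g4⟩
      have hB' : Base s' := base_congr hB fun i hi => g3 i (by omega)
      refine (hpv' s' (g1 ▸ hEq _ _ _ _)).mono le_rfl ?_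
      rintro _ rfl
      refine ⟨hB', (g3 7 (by omega)).trans h7, (g3 8 (by omega)).trans h8, g2, ?_⟩
      simp only [NatExpr.eval]
      rw [hB'.2.2.2.2.2.1, g1, g4]
    · rintro s' ⟨hB', g7, g8, g10, gf⟩
      refine (ends_setField _ _ _).mono (by simp [NatExpr.cost, FieldExpr.cost]) ?_
      rintro _ rfl
      have hp := hlt k hk a ha
      obtain ⟨-, -, -, -, b4, b5, -⟩ := id hB'
      refine ⟨hB', g7, g8, fun i hi => ?_, fun i hi => ?_, ?_⟩
      · have n1 : NN + m * n + i ≠ NN + m * n + m * n := by omega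
        have n2 : NN + m * n + i ≠ NN + m * n + m * n + 1 := by omega
        simp only [NatExpr.eval, b5, gf, Function.update_of_ne n1, Function.update_of_ne n2]
        exact hC i hi
      · have n1 : i ≠ NN + m * n + m * n := by omega
        have n2 : i ≠ NN + m * n + m * n + 1 := by omega
        simp only [NatExpr.eval, b5, gf, Function.update_of_ne n1, Function.update_of_ne n2]
        exact ho i hi
      · have n1 : NN + m * n + m * n ≠ NN + m * n + m * n + 1 := by omega
        have n2 : NN + m * n + pos m n k a ≠ NN + m * n + m * n + 1 := by omega
        simp only [NatExpr.eval, FieldExpr.eval, b4, b5, gf, g10, Function.update_self,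
          Function.update_of_ne n1, Function.update_of_ne n2]
        rw [hC _ hp, hacc, Finset.sum_range_succ, add_assoc]
    · rintro s' ⟨hB', g7, g8, gC, go, gacc⟩
      refine (inc_ends 8 s').mono le_rfl ?_
      rintro s'' ⟨k1, k2, k3⟩
      refine ⟨base_congr hB' fun i hi => k2 i (by omega), (k2 7 (by omega)).trans g7, by rw [k1, g8],
        fun i hi => ?_, fun i hi => ?_, ?_⟩
      · rw [k3]; exact gC i hi
      · rw [k3]; exact go i hi
      · rw [k3]; exact gacc
  have outer : ∀ k < NN, ∀ s, J k s → Ends outerBody s (cOut ![m, n]) (J (k + 1)) := by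
    rintro k hk s ⟨hB, h7, hC, ho⟩
    have hSle : ∑ i, s.nat (![0, 1, 7] i) + 2 ≤ S ![m, n] := by
      rw [hS, Fin.sum_univ_three]
      change s.nat 0 + s.nat 1 + s.nat 7 + 2 ≤ _
      have := hB.1
      have := hB.2.1
      omega
    have e1 : Ends pW s (S ![m, n] ^ eW) fun s' =>
        s'.nat 9 = W m n k ∧ (∀ i < 9, s'.nat i = s.nat i) ∧ s'.field = s.field := by
      refine (hpW s).mono ((hτW _).trans (Nat.pow_le_pow_left hSle _)) ?_
      rintro s' ⟨g1, g2, g3⟩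
      refine ⟨?_, g2, g3⟩
      rw [← hB.1, ← hB.2.1, ← h7]
      exact g1
    refine Ends.mono (τ := S ![m, n] ^ eW + τv + 3 + (m * (cIn ![m, n] + 5 + 1) + 5 + 1) + 6 + 6)
      (Ends.seq (R := fun s' => Base s' ∧ s'.nat 7 = k ∧ Copied s' ∧
        ∀ i < k + 1, s'.field i = out i)
      (Ends.seq (R := K k m) (Ends.seq (R := K k 0) (Ends.seq (R := fun s' => Base s' ∧
        s'.nat 7 = k ∧ s'.field = Function.update s.field (NN + m * n + m * n) (val (W m n k)))
        (e1.seq ?_) ?_) ?_) ?_) ?_) (by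
          simp only [cOut, Matrix.cons_val_zero, add_assoc, Nat.reduceAdd]
          omega) fun _ h => h
    · rintro s' ⟨g1, g2, g3⟩
      have hB' : Base s' := base_congr hB fun i hi => g2 i (by omega)
      refine (hpv s' (g1 ▸ hWq _ _ _)).mono le_rfl ?_
      rintro _ rfl
      refine ⟨hB', (g2 7 (by omega)).trans h7, ?_⟩
      simp only [NatExpr.eval]
      rw [hB'.2.2.2.2.2.1, g1, g3]
    · rintro s' ⟨hB', g7, gf⟩
      refine (zero_ends 8 s').mono le_rfl ?_
      rintro s'' ⟨k1, k2, k3⟩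
      refine ⟨base_congr hB' fun i hi => k2 i (by omega), (k2 7 (by omega)).trans g7, k1,
        fun i hi => ?_, fun i hi => ?_, ?_⟩
      · have n1 : NN + m * n + i ≠ NN + m * n + m * n := by omega
        rw [k3, gf, Function.update_of_ne n1]
        exact hC i hi
      · have n1 : i ≠ NN + m * n + m * n := by omega
        rw [k3, gf, Function.update_of_ne n1]
        exact ho i hi
      · rw [k3, gf]
        simp
    · intro s' hs'
      refine (ends_while (K k) m (cIn ![m, n]) (fun a ha s'' hs'' => ⟨?_, inner k hk a ha s'' hs''⟩)
        (fun s'' hs'' => ?_) hs').mono (by simp [NatExpr.cost]) fun _ h => h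
      · simp [NatExpr.eval, hs''.1.1, hs''.2.2.1]
        omega
      · simp [NatExpr.eval, hs''.1.1, hs''.2.2.1]
    · rintro s' ⟨hB', g7, g8, gC, go, gacc⟩
      refine (ends_setField _ _ _).mono (by simp [NatExpr.cost, FieldExpr.cost]) ?_
      rintro _ rfl
      refine ⟨hB', g7, fun i hi => ?_, fun i hi => ?_⟩
      · have n1 : NN + m * n + i ≠ k := by omega
        simp only [NatExpr.eval, g7, Function.update_of_ne n1]
        exact gC i hi
      · simp only [NatExpr.eval, FieldExpr.eval, g7, hB'.2.2.2.2.2.1, gacc]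
        rcases Nat.lt_succ_iff_lt_or_eq.mp hi with h | rfl
        · rw [Function.update_of_ne h.ne, go i h]
        · simp [out]
    · rintro s' ⟨hB', g7, gC, go⟩
      refine (inc_ends 7 s').mono le_rfl ?_
      rintro s'' ⟨k1, k2, k3⟩
      refine ⟨base_congr hB' fun i hi => k2 i (by omega), by rw [k1, g7],
        fun i hi => ?_, fun i hi => ?_⟩
      · rw [k3]; exact gC i hi
      · rw [k3]; exact go i hi
  have copy : ∀ k < m * n, ∀ s, I k s → Ends copyBody s 15 (I (k + 1)) := by
    rintro k hk s ⟨hB, h7, hi, hc⟩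
    refine Ends.seq (τ₁ := 9) (τ₂ := 6) (R := fun s' => Base s' ∧ s'.nat 7 = k ∧
      (∀ i < m * n, s'.field i = x i) ∧ ∀ i < k + 1, s'.field (NN + m * n + i) = x i)
      ((ends_setField _ _ _).mono (by simp [NatExpr.cost, FieldExpr.cost]) ?_) ?_
    · rintro _ rfl
      simp only [NatExpr.eval, FieldExpr.eval, h7, hB.2.2.2.2.1]
      refine ⟨hB, trivial, fun i hi' => ?_, fun i hi' => ?_⟩
      · rw [Function.update_of_ne (by omega), hi i hi']
      · rcases Nat.lt_succ_iff_lt_or_eq.mp hi' with h | rfl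
        · rw [Function.update_of_ne (by omega), hc i h]
        · rw [Function.update_self, hi i hk]
    · rintro s' ⟨hB', g7, g8, g9⟩
      refine (inc_ends 7 s').mono le_rfl ?_
      rintro s'' ⟨k1, k2, k3⟩
      refine ⟨base_congr hB' fun i hi => k2 i (by omega), by rw [k1, g7],
        fun i hi => ?_, fun i hi => ?_⟩
      · rw [k3]; exact g8 i hi
      · rw [k3]; exact g9 i hi
  refine Ends.mono (τ := τ₀ ![m, n] + 3 + (m * n * (15 + 5 + 1) + 5 + 1) + 3 +
    (NN * (cOut ![m, n] + 5 + 1) + 5 + 1) + 4)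
    (Ends.seq (R := J NN) (Ends.seq (R := J 0) (Ends.seq (R := I (m * n)) (Ends.seq (R := I 0)
    (Ends.seq (R := fun s => Base s ∧ s.field = x) ?_ ?_) ?_) ?_) ?_) ?_) (by
      simp only [cost, R, Matrix.cons_val_zero, Matrix.cons_val_one, ← hNNdef, add_assoc,
        Nat.reduceAdd]
      omega) fun _ h => h
  · refine (hp₀ (inputState M)).mono (le_of_eq ?_) ?_
    · congr 1
      funext i
      fin_cases i <;> rfl
    · rintro s' ⟨g1, g2, g3⟩
      exact ⟨⟨g2 0 (by omega), g2 1 (by omega), g1 0, g1 1, g1 2, g1 3, g1 4⟩, g3⟩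
  · rintro s' ⟨hB', g⟩
    refine (zero_ends 7 s').mono le_rfl ?_
    rintro s'' ⟨k1, k2, k3⟩
    exact ⟨base_congr hB' fun i hi => k2 i (by omega), k1, fun i _ => by rw [k3, g],
      fun i hi => absurd hi (Nat.not_lt_zero _)⟩
  · intro s' hs'
    refine (ends_while I (m * n) 15 (fun a ha s'' hs'' => ⟨?_, copy a ha s'' hs''⟩)
      (fun s'' hs'' => ?_) hs').mono (by simp [NatExpr.cost]) fun _ h => h
    · simp [NatExpr.eval, hs''.1.2.2.2.2.2.2, hs''.2.1]
      omega
    · simp [NatExpr.eval, hs''.1.2.2.2.2.2.2, hs''.2.1]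
  · rintro s' ⟨hB', g1, g2, g3⟩
    refine (zero_ends 7 s').mono le_rfl ?_
    rintro s'' ⟨k1, k2, k3⟩
    exact ⟨base_congr hB' fun i hi => k2 i (by omega), k1, fun i hi => by rw [k3, g3 i hi],
      fun i hi => absurd hi (Nat.not_lt_zero _)⟩
  · intro s' hs'
    refine (ends_while J NN (cOut ![m, n]) (fun a ha s'' hs'' => ⟨?_, outer a ha s'' hs''⟩)
      (fun s'' hs'' => ?_) hs').mono (by simp [NatExpr.cost]) fun _ h => h
    · simp [NatExpr.eval, hs''.1.2.2.2.1, hs''.2.1]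
      omega
    · simp [NatExpr.eval, hs''.1.2.2.2.1, hs''.2.1]
  · rintro s' ⟨hB', g1, g2, g3⟩
    refine (ends_setNat _ _ _).mono (by simp [NatExpr.cost]) ?_
    rintro _ rfl
    exact ⟨by simp [NatExpr.eval, hB'.2.2.1], g3⟩

end
end RAM

section
open Polynomial

namespace RAM

/-! ### Digits -/

theorem digit_lt {b : ℕ} (hb : 0 < b) (x i : ℕ) : digit b x i < b := Nat.mod_lt _ hb

theorem digit_succ (b x i : ℕ) : digit b x (i + 1) = digit b (x / b) i := by
  rw [digit, digit, Nat.div_div_eq_div_mul, pow_succ']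

theorem digit_zero (b x : ℕ) : digit b x 0 = x % b := by simp [digit]

theorem digit_of_lt_pow {b x L i : ℕ} (hb : 1 < b) (hx : x < b ^ L) (hi : L ≤ i) :
    digit b x i = 0 := by
  rw [digit, Nat.div_eq_of_lt (hx.trans_le (Nat.pow_le_pow_right hb.le hi)), Nat.zero_mod]

theorem digit_of_le {b x i : ℕ} (hb : 1 < b) (hi : x ≤ i) : digit b x i = 0 :=
  digit_of_lt_pow hb (Nat.lt_pow_self hb) hi

theorem exists_digits {b : ℕ} (hb : 1 < b) (L : ℕ) : ∀ d : ℕ → ℕ, (∀ i, d i < b) →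
    ∃ x < b ^ L, ∀ i, digit b x i = if i < L then d i else 0 := by
  induction L with
  | zero => exact fun d _ => ⟨0, by simp, fun i => by simp [digit]⟩
  | succ L ih =>
    intro d hd
    obtain ⟨x, hx, h⟩ := ih (fun i => d (i + 1)) fun i => hd _
    refine ⟨d 0 + b * x, ?_, fun i => ?_⟩
    · have := hd 0
      rw [pow_succ']
      calc d 0 + b * x < b * (x + 1) := by rw [mul_add]; omega
        _ ≤ b * b ^ L := Nat.mul_le_mul_left _ hx
    · cases i with
      | zero => simp [digit_zero, Nat.mod_eq_of_lt (hd 0)]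
      | succ i =>
        rw [digit_succ, Nat.add_mul_div_left _ _ (by omega), Nat.div_eq_of_lt (hd 0), zero_add, h]
        simp

theorem digit_ext {b : ℕ} (hb : 1 < b) {x y : ℕ} (h : ∀ i, digit b x i = digit b y i) : x = y := by
  induction hn : x + y using Nat.strong_induction_on generalizing x y with
  | _ n ih =>
    rcases Nat.eq_zero_or_pos n with h0 | h0
    · omega
    have h1 : x / b + y / b < n := by
      rw [← hn]
      rcases Nat.eq_zero_or_pos x with hx | hx
      · have := Nat.div_lt_self (show 0 < y by omega) hb
        simp [hx, this]
      · have := Nat.div_lt_self hx hb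
        have := Nat.div_le_self y b
        omega
    have h2 := ih _ h1 (fun i => by rw [← digit_succ, ← digit_succ, h]) rfl
    have h3 := h 0
    rw [digit_zero, digit_zero] at h3
    rw [← Nat.div_add_mod x b, ← Nat.div_add_mod y b, h2, h3]

theorem lt_pow_iff_digit {b : ℕ} (hb : 1 < b) {x L : ℕ} :
    x < b ^ L ↔ ∀ i, L ≤ i → digit b x i = 0 := by
  refine ⟨fun h i hi => digit_of_lt_pow hb h hi, fun h => ?_⟩
  obtain ⟨y, hy, h'⟩ := exists_digits hb L (digit b x) fun i => digit_lt (by omega) x i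
  have : x = y := digit_ext hb fun i => by
    rw [h']
    split_ifs with hi
    · rfl
    · exact h i (by omega)
  exact this ▸ hy

/-! ### Polynomials as numbers -/

/-- A numbering of the finite field `F` by the numbers `< q`. -/
structure Numbering (F : Type*) [Field F] where
  q : ℕ
  val : ℕ → F
  code : F → ℕ
  code_lt : ∀ x, code x < q
  val_code : ∀ x, val (code x) = x
  code_val : ∀ c < q, code (val c) = c
  val_zero : val 0 = 0
  val_one : val 1 = 1
  one_lt : 1 < q

theorem exists_numbering (F : Type*) [Field F] [Finite F] :
    ∃ ν : Numbering F, ν.q = Nat.card F := by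
  classical
  have h1 : 1 < Nat.card F := Finite.one_lt_card
  have : NeZero (Nat.card F) := ⟨by omega⟩
  let z : Fin (Nat.card F) := ⟨0, by omega⟩
  let o : Fin (Nat.card F) := ⟨1, h1⟩
  have hzo : z ≠ o := by simp [z, o]
  -- Two transpositions correct an arbitrary bijection: one brings `0` to `0`, the next brings `1`
  -- to `1` and does not move the image of `0`.
  let e₁ := (Finite.equivFin F).trans (Equiv.swap (Finite.equivFin F 0) z)
  have h₁ : e₁ 0 = z := by simp [e₁]
  let e := e₁.trans (Equiv.swap (e₁ 1) o)
  have he1 : e 1 = o := by simp [e]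
  have he0 : e 0 = z := by
    have : e₁ 1 ≠ z := h₁ ▸ e₁.injective.ne one_ne_zero
    simp only [e, Equiv.trans_apply, h₁]
    exact Equiv.swap_apply_of_ne_of_ne this.symm hzo
  refine ⟨⟨Nat.card F, fun c => if h : c < Nat.card F then e.symm ⟨c, h⟩ else 0, fun x => e x,
    fun x => (e x).2, fun x => by simp, fun c hc => by simp [hc], ?_, ?_, h1⟩, rfl⟩
  · rw [dif_pos (by omega), Equiv.symm_apply_eq, he0]
  · rw [dif_pos h1, Equiv.symm_apply_eq, he1]

namespace Numbering

variable {F : Type*} [Field F] (ν : Numbering F)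

theorem code_zero : ν.code 0 = 0 := by
  rw [← ν.val_zero, ν.code_val _ (by have := ν.one_lt; omega)]

theorem code_one : ν.code 1 = 1 := by rw [← ν.val_one, ν.code_val _ ν.one_lt]

theorem q_pos : 0 < ν.q := by have := ν.one_lt; omega

/-- The polynomial whose coefficients are coded by the digits of `x`. -/
noncomputable def dec (x : ℕ) : F[X] := ∑ i ∈ Finset.range x, C (ν.val (digit ν.q x i)) * X ^ i

theorem coeff_dec (x i : ℕ) : (ν.dec x).coeff i = ν.val (digit ν.q x i) := by
  simp only [dec, finsetSum_coeff, coeff_C_mul_X_pow]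
  rw [Finset.sum_ite_eq, ite_eq_left_iff, Finset.mem_range, not_lt]
  intro h
  rw [digit_of_le ν.one_lt h, ν.val_zero]

theorem digit_eq_code (x i : ℕ) : digit ν.q x i = ν.code ((ν.dec x).coeff i) := by
  rw [coeff_dec, ν.code_val _ (digit_lt ν.q_pos _ _)]

theorem dec_injective : Function.Injective ν.dec := fun x y h =>
  digit_ext ν.one_lt fun i => by rw [digit_eq_code, digit_eq_code, h]

/-- Degree bounds are bounds on numbers, so a search over all polynomials of degree less than `L` is
a search below `q ^ L`. -/
theorem lt_pow_iff {x L : ℕ} : x < ν.q ^ L ↔ (ν.dec x).degree < L := by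
  rw [lt_pow_iff_digit ν.one_lt, degree_lt_iff_coeff_zero]
  refine forall₂_congr fun i _ => ?_
  rw [digit_eq_code]
  constructor
  · intro h
    rw [← ν.val_code ((ν.dec x).coeff i), h, ν.val_zero]
  · intro h
    rw [h, code_zero]

theorem dec_surjective : Function.Surjective ν.dec := fun f => by
  obtain ⟨x, -, h⟩ := exists_digits ν.one_lt (f.natDegree + 1) (fun i => ν.code (f.coeff i))
    fun i => ν.code_lt _
  refine ⟨x, ext fun i => ?_⟩
  rw [coeff_dec, h]
  split_ifs with hi
  · rw [ν.val_code]
  · rw [ν.val_zero, coeff_eq_zero_of_natDegree_lt (by omega)]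

/-- The number of a polynomial. -/
noncomputable def enc (f : F[X]) : ℕ := Function.surjInv ν.dec_surjective f

@[simp] theorem dec_enc (f : F[X]) : ν.dec (ν.enc f) = f := Function.surjInv_eq _ f

@[simp] theorem enc_dec (x : ℕ) : ν.enc (ν.dec x) = x := ν.dec_injective (ν.dec_enc _)

theorem enc_lt_pow_iff {f : F[X]} {L : ℕ} : ν.enc f < ν.q ^ L ↔ f.degree < L := by
  rw [lt_pow_iff, dec_enc]

theorem dec_one : ν.dec 1 = 1 := by simp [dec, digit_zero, Nat.mod_eq_of_lt ν.one_lt, ν.val_one]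

theorem lt_pow_natDegree (x : ℕ) : x < ν.q ^ ((ν.dec x).natDegree + 1) := by
  rw [lt_pow_iff]
  exact degree_le_natDegree.trans_lt (by exact_mod_cast Nat.lt_succ_self _)

/-- With this, sums and products of polynomials have numbers polynomially bounded in those of the
operands. The `+ 1` is for `x = 0`, where the degree is read as `0`. -/
theorem pow_natDegree_le (x : ℕ) : ν.q ^ (ν.dec x).natDegree ≤ x + 1 := by
  by_contra h
  have h1 : x < ν.q ^ (ν.dec x).natDegree := by omega
  rw [lt_pow_iff] at h1
  by_cases h0 : ν.dec x = 0
  · simp [h0] at h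
  · rw [degree_eq_natDegree h0] at h1
    exact lt_irrefl _ h1

theorem natDegree_dec_le (x : ℕ) : (ν.dec x).natDegree ≤ x := by
  have := (Nat.lt_pow_self ν.one_lt).trans_le (ν.pow_natDegree_le x)
  omega

/-- Addition in `F` on numbers. -/
noncomputable def addCode (c d : ℕ) : ℕ :=
  if c < ν.q ∧ d < ν.q then ν.code (ν.val c + ν.val d) else 0

/-- Multiplication in `F` on numbers. -/
noncomputable def mulCode (c d : ℕ) : ℕ :=
  if c < ν.q ∧ d < ν.q then ν.code (ν.val c * ν.val d) else 0

theorem polyTime₂_addCode : PolyTime₂ F ν.addCode :=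
  polyTime₂_of_support ν.q fun x y h => by
    by_contra h'
    exact h (if_neg h')

theorem polyTime₂_mulCode : PolyTime₂ F ν.mulCode :=
  polyTime₂_of_support ν.q fun x y h => by
    by_contra h'
    exact h (if_neg h')

theorem addCode_code (x y : F) : ν.addCode (ν.code x) (ν.code y) = ν.code (x + y) := by
  simp [addCode, ν.code_lt, ν.val_code]

theorem mulCode_code (x y : F) : ν.mulCode (ν.code x) (ν.code y) = ν.code (x * y) := by
  simp [mulCode, ν.code_lt, ν.val_code]

/-- Addition of polynomials on numbers. -/
noncomputable def padd (x y : ℕ) : ℕ := ν.enc (ν.dec x + ν.dec y)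

/-- Multiplication of polynomials on numbers. -/
noncomputable def pmul (x y : ℕ) : ℕ := ν.enc (ν.dec x * ν.dec y)

/-- From `b` on, all digits of `z` and all coefficients of `f` vanish. The graph of an operation on
polynomials thus becomes a bounded comparison of digits, as `PolyTime.of_graph` needs. -/
theorem eq_enc_iff {z : ℕ} {f : F[X]} {b : ℕ} (hz : z ≤ b) (hf : f.natDegree < b) :
    z = ν.enc f ↔ ∀ i < b, digit ν.q z i = ν.code (f.coeff i) := by
  constructor
  · rintro rfl i -
    rw [digit_eq_code, dec_enc]
  · intro h
    refine digit_ext ν.one_lt fun i => ?_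
    rw [digit_eq_code ν (ν.enc f), dec_enc]
    by_cases hi : i < b
    · exact h i hi
    · rw [digit_of_le ν.one_lt (by omega), coeff_eq_zero_of_natDegree_lt (by omega), code_zero]

theorem enc_le {f : F[X]} {a b : ℕ} (h : f.natDegree ≤ a) (hb : ν.q ^ a ≤ b) :
    ν.enc f ≤ ν.q * b := by
  have h1 := ν.lt_pow_natDegree (ν.enc f)
  rw [dec_enc, pow_succ'] at h1
  exact h1.le.trans (Nat.mul_le_mul_left _ ((Nat.pow_le_pow_right ν.q_pos h).trans hb))

theorem polyTime₂_padd : PolyTime₂ F ν.padd := by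
  refine PolyTime.of_graph (B := fun v => ν.q * (v 0 + 1 + (v 1 + 1)))
    (R := fun z v => ∀ i < z + v 0 + v 1 + 1,
      digit ν.q z i = ν.addCode (digit ν.q (v 0) i) (digit ν.q (v 1) i))
    (polyTime₂_mul.comp (.const _) (polyTime₂_add.comp (polyTime₂_add.comp (.proj 0) (.const 1))
      (polyTime₂_add.comp (.proj 1) (.const 1)))) ?_ (fun v => ?_) fun v z _ => ?_
  · refine PolyDec.forall_lt (polyTime₂_add.comp (polyTime₂_add.comp (polyTime₂_add.comp
      (.proj _) (.proj _)) (.proj _)) (.const 1)) ?_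
    exact PolyDec.eq (polyTime₃_digit.comp (.const _) (.proj _) (.proj _))
      (ν.polyTime₂_addCode.comp (polyTime₃_digit.comp (.const _) (.proj _) (.proj _))
        (polyTime₃_digit.comp (.const _) (.proj _) (.proj _)))
  · refine ν.enc_le (natDegree_add_le _ _) ?_
    have := ν.pow_natDegree_le (v 0)
    have := ν.pow_natDegree_le (v 1)
    rcases max_cases (ν.dec (v 0)).natDegree (ν.dec (v 1)).natDegree with h | h <;>
      rw [h.1] <;> omega
  · rw [padd, ν.eq_enc_iff (b := z + v 0 + v 1 + 1) (by omega) (by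
      have := natDegree_add_le (ν.dec (v 0)) (ν.dec (v 1))
      have := ν.natDegree_dec_le (v 0)
      have := ν.natDegree_dec_le (v 1)
      omega)]
    simp only [coeff_add, ← addCode_code, ← digit_eq_code]

theorem polyTime₃_coeff_mul :
    PolyTime₃ F (fun x y i => ν.code ((ν.dec x * ν.dec y).coeff i)) := by
  have h : ∀ (v : Fin 3 → ℕ) (k : ℕ), Nat.rec (motive := fun _ => ℕ) 0 (fun j r =>
      ν.addCode r (ν.mulCode (digit ν.q (v 0) j) (digit ν.q (v 1) (v 2 - j)))) k =
      ν.code (∑ j ∈ Finset.range k, (ν.dec (v 0)).coeff j * (ν.dec (v 1)).coeff (v 2 - j)) := by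
    intro v k
    induction k with
    | zero => simp [code_zero]
    | succ k ih =>
      rw [Finset.sum_range_succ, ← addCode_code, ← ih, ← mulCode_code, ← digit_eq_code,
        ← digit_eq_code]
  have := PolyTime.natRec (F := F) (j := 3) (base := fun _ => 0) (cnt := fun v => v 2 + 1)
    (step := fun j r v =>
      ν.addCode r (ν.mulCode (digit ν.q (v 0) j) (digit ν.q (v 1) (v 2 - j))))
    (.const 0) (polyTime₂_add.comp (.proj 2) (.const 1))
    (ν.polyTime₂_addCode.comp (.proj 1) (ν.polyTime₂_mulCode.comp
      (polyTime₃_digit.comp (.const _) (.proj _) (.proj 0))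
      (polyTime₃_digit.comp (.const _) (.proj _) (polyTime₂_sub.comp (.proj _) (.proj 0)))))
    (bd := fun _ => ν.q) (.const _) (fun v i hi => by rw [h]; exact (ν.code_lt _).le)
  unfold PolyTime₃
  convert this using 2 with v
  refine Eq.trans ?_ (h v (v 2 + 1)).symm
  simp only
  rw [coeff_mul, Finset.Nat.sum_antidiagonal_eq_sum_range_succ_mk]

theorem polyTime₂_pmul : PolyTime₂ F ν.pmul := by
  refine PolyTime.of_graph (B := fun v => ν.q * ((v 0 + 1) * (v 1 + 1)))
    (R := fun z v => ∀ i < z + v 0 + v 1 + 1,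
      digit ν.q z i = ν.code ((ν.dec (v 0) * ν.dec (v 1)).coeff i))
    (polyTime₂_mul.comp (.const _) (polyTime₂_mul.comp (polyTime₂_add.comp (.proj 0) (.const 1))
      (polyTime₂_add.comp (.proj 1) (.const 1)))) ?_ (fun v => ?_) fun v z _ => ?_
  · refine PolyDec.forall_lt (polyTime₂_add.comp (polyTime₂_add.comp (polyTime₂_add.comp
      (.proj _) (.proj _)) (.proj _)) (.const 1)) ?_
    exact PolyDec.eq (polyTime₃_digit.comp (.const _) (.proj _) (.proj _))
      (ν.polyTime₃_coeff_mul.comp (.proj _) (.proj _) (.proj _))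
  · refine ν.enc_le natDegree_mul_le ?_
    rw [pow_add]
    exact Nat.mul_le_mul (ν.pow_natDegree_le _) (ν.pow_natDegree_le _)
  · rw [pmul, ν.eq_enc_iff (b := z + v 0 + v 1 + 1) (by omega) (by
      have := natDegree_mul_le (p := ν.dec (v 0)) (q := ν.dec (v 1))
      have := ν.natDegree_dec_le (v 0)
      have := ν.natDegree_dec_le (v 1)
      omega)]

end Numbering
end RAM

end

/-! ### Arithmetic in extension fields by exhaustive search. -/

section
open Polynomial

/-- Over a finite field there are irreducible polynomials of every positive degree. -/
theorem FiniteField.exists_monic_irreducible (F : Type*) [Field F] [Finite F] {k : ℕ} (hk : 0 < k) :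
    ∃ f : F[X], f.Monic ∧ Irreducible f ∧ f.natDegree = k := by
  obtain ⟨p, hp⟩ := CharP.exists F
  have : Fact p.Prime := ⟨CharP.char_is_prime F p⟩
  have : NeZero k := ⟨hk.ne'⟩
  let L := FiniteField.Extension F p k
  obtain ⟨α, hα⟩ := Field.exists_primitive_element F L
  have hint : IsIntegral F α := Algebra.IsIntegral.isIntegral α
  refine ⟨minpoly F α, minpoly.monic hint, minpoly.irreducible hint, ?_⟩
  rw [(Field.primitive_element_iff_minpoly_natDegree_eq F α).mp hα]
  exact FiniteField.finrank_extension F p k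

namespace RAM
namespace Numbering

variable {F : Type*} [Field F] (ν : Numbering F)

/-! ### Irreducible polynomials -/

/-- The polynomial with number `x` has no proper factorization. -/
def PIrred (x : ℕ) : Prop := ∀ u < x, ∀ v < x, ¬ (ν.q ≤ u ∧ ν.q ≤ v ∧ ν.pmul u v = x)

theorem polyDec_pIrred : PolyDec F (fun v : Fin 1 → ℕ => ν.PIrred (v 0)) := by
  refine PolyDec.forall_lt (R := fun u v => ∀ w < v 0, ¬ (ν.q ≤ u ∧ ν.q ≤ w ∧ ν.pmul u w = v 0))
    (.proj 0) ?_
  refine PolyDec.forall_lt (R := fun w v => ¬ (ν.q ≤ v 0 ∧ ν.q ≤ w ∧ ν.pmul (v 0) w = v 1))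
    (.proj _) ?_
  exact ((PolyDec.le (.const _) (.proj _)).and ((PolyDec.le (.const _) (.proj _)).and
    (PolyDec.eq (ν.polyTime₂_pmul.comp (.proj _) (.proj _)) (.proj _)))).not

theorem q_le_iff (x : ℕ) : ν.q ≤ x ↔ 0 < (ν.dec x).natDegree := by
  have h := ν.lt_pow_iff (x := x) (L := 1)
  rw [pow_one] at h
  rw [← not_lt, h]
  by_cases h0 : ν.dec x = 0
  · simp [h0]
  · rw [degree_eq_natDegree h0]
    norm_cast
    omega

/-- The factors of a proper factorization have smaller degree than the product, hence smaller
numbers, so testing factors below `x` is enough. Nonconstant polynomials are those with number at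
least `q`. -/
theorem PIrred.irreducible {x : ℕ} (hx : ν.q ≤ x) (h : ν.PIrred x) : Irreducible (ν.dec x) := by
  have hdeg := (ν.q_le_iff x).mp hx
  have h0 : ν.dec x ≠ 0 := by
    intro h0
    simp [h0] at hdeg
  refine ⟨fun hu => hdeg.ne' (natDegree_eq_zero_of_isUnit hu), fun {f g} hfg => ?_⟩
  by_contra! hfg'
  have hf0 : f ≠ 0 := fun h => h0 (by rw [hfg, h, zero_mul])
  have hg0 : g ≠ 0 := fun h => h0 (by rw [hfg, h, mul_zero])
  have pos : ∀ {f : F[X]}, f ≠ 0 → ¬ IsUnit f → 0 < f.natDegree := by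
    intro f hf hf'
    by_contra h
    obtain ⟨c, rfl⟩ := natDegree_eq_zero.mp (by omega : f.natDegree = 0)
    exact hf' (isUnit_C.mpr (isUnit_iff_ne_zero.mpr fun h => hf (by rw [h, C_0])))
  have hf1 := pos hf0 hfg'.1
  have hg1 := pos hg0 hfg'.2
  have hd : (ν.dec x).natDegree = f.natDegree + g.natDegree := by
    rw [hfg, natDegree_mul hf0 hg0]
  have lt : ∀ {f : F[X]}, f.natDegree < (ν.dec x).natDegree → ν.enc f < x := by
    intro f hf
    by_contra hle
    have h1 : x < ν.q ^ (ν.dec x).natDegree := by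
      refine lt_of_le_of_lt (not_lt.mp hle) (ν.enc_lt_pow_iff.mpr ?_)
      exact degree_le_natDegree.trans_lt (by exact_mod_cast hf)
    rw [lt_pow_iff, degree_eq_natDegree h0] at h1
    exact lt_irrefl _ h1
  refine h (ν.enc f) (lt (by omega)) (ν.enc g) (lt (by omega)) ⟨?_, ?_, ?_⟩
  · rwa [q_le_iff, dec_enc]
  · rwa [q_le_iff, dec_enc]
  · rw [pmul, dec_enc, dec_enc, ← hfg, enc_dec]

theorem pIrred_of_irreducible {x : ℕ} (h : Irreducible (ν.dec x)) : ν.PIrred x := by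
  rintro u - v - ⟨hu, hv, rfl⟩
  rw [q_le_iff] at hu hv
  rw [pmul, dec_enc] at h
  rcases h.isUnit_or_isUnit rfl with h | h
  · exact hu.ne' (natDegree_eq_zero_of_isUnit h)
  · exact hv.ne' (natDegree_eq_zero_of_isUnit h)

/-- In this interval digit `k` is `1` and all higher digits are `0`, and the code `1` stands for the
field element `1`. -/
theorem monic_dec {k x : ℕ} (h1 : ν.q ^ k ≤ x) (h2 : x < 2 * ν.q ^ k) :
    (ν.dec x).Monic ∧ (ν.dec x).natDegree = k := by
  have hq := ν.one_lt
  have h3 : x < ν.q ^ (k + 1) := by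
    rw [pow_succ']
    exact h2.trans_le (Nat.mul_le_mul_right _ hq)
  have hle : (ν.dec x).natDegree ≤ k := by
    by_cases h0 : ν.dec x = 0
    · simp [h0]
    · rw [lt_pow_iff, degree_eq_natDegree h0] at h3
      norm_cast at h3
      omega
  have hc : (ν.dec x).coeff k = 1 := by
    rw [coeff_dec, digit, show x / ν.q ^ k = 1 from ?_, Nat.mod_eq_of_lt hq, ν.val_one]
    rw [Nat.div_eq_iff (by positivity [ν.q_pos])]
    omega
  have hm := monic_of_natDegree_le_of_coeff_eq_one k hle hc
  refine ⟨hm, le_antisymm hle (le_natDegree_of_ne_zero ?_)⟩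
  rw [hc]
  exact one_ne_zero

theorem exists_pIrred [Finite F] {k : ℕ} (hk : 0 < k) :
    ∃ x < 2 * ν.q ^ k, ν.q ^ k ≤ x ∧ ν.PIrred x := by
  obtain ⟨f, hm, hirr, hdeg⟩ := FiniteField.exists_monic_irreducible F hk
  have hpos : 0 < ν.q ^ k := pow_pos ν.q_pos k
  have h1 : ν.enc f / ν.q ^ k = 1 := by
    have h2 : ν.enc f < ν.q ^ (k + 1) := by
      simpa [hdeg] using ν.lt_pow_natDegree (ν.enc f)
    have h3 : digit ν.q (ν.enc f) k = 1 := by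
      rw [digit_eq_code, dec_enc, ← hdeg, hm.coeff_natDegree, code_one]
    rwa [digit, Nat.mod_eq_of_lt] at h3
    rw [Nat.div_lt_iff_lt_mul hpos, ← pow_succ']
    exact h2
  refine ⟨ν.enc f, ?_, ?_, ν.pIrred_of_irreducible (by rwa [dec_enc])⟩
  · rw [Nat.div_eq_iff hpos] at h1
    omega
  · rw [Nat.div_eq_iff hpos] at h1
    omega

/-- The number of a monic irreducible polynomial of degree `k`, where `Q = q ^ k`. -/
noncomputable def irrPoly (Q : ℕ) : ℕ := leastBelow (2 * Q) fun x => Q ≤ x ∧ ν.PIrred x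

theorem polyTime₁_irrPoly : PolyTime₁ F ν.irrPoly := by
  refine PolyTime.leastBelow (R := fun x v => v 0 ≤ x ∧ ν.PIrred x)
    (polyTime₂_mul.comp (.const 2) (.proj 0)) (.and (.le (.proj _) (.proj _)) ?_)
  exact PolyTime.comp (g := fun _ w => w 0) ν.polyDec_pIrred fun _ => .proj _

theorem irrPoly_spec [Finite F] {k : ℕ} (hk : 0 < k) :
    (ν.dec (ν.irrPoly (ν.q ^ k))).Monic ∧ (ν.dec (ν.irrPoly (ν.q ^ k))).natDegree = k ∧
      Irreducible (ν.dec (ν.irrPoly (ν.q ^ k))) := by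
  have h := leastBelow_lt_iff.mpr (ν.exists_pIrred hk)
  obtain ⟨h1, h2⟩ := (leastBelow_spec (2 * ν.q ^ k) fun x => ν.q ^ k ≤ x ∧ ν.PIrred x).2.2 h
  obtain ⟨h3, h4⟩ := ν.monic_dec h1 h
  exact ⟨h3, h4, PIrred.irreducible ν ((Nat.le_self_pow hk.ne' _).trans h1) h2⟩

/-! ### Arithmetic modulo a polynomial -/

/-- Multiplication modulo the polynomial `p`, on numbers `< Q`. -/
noncomputable def kmul (Q p x y : ℕ) : ℕ :=
  leastBelow Q fun w => ∃ u < Q, ν.pmul x y = ν.padd (ν.pmul u p) w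

/-- Subtraction of polynomials on numbers `< Q`. -/
noncomputable def ksub (Q x y : ℕ) : ℕ := leastBelow Q fun w => ν.padd w y = x

/-- Inversion modulo the polynomial `p`, on numbers `< Q`. -/
noncomputable def kinv (Q p x : ℕ) : ℕ := leastBelow Q fun w => ν.kmul Q p x w = 1

theorem polyTime₄_kmul : PolyTime₄ F ν.kmul := by
  refine PolyTime.leastBelow (R := fun w v => ∃ u < v 0,
    ν.pmul (v 2) (v 3) = ν.padd (ν.pmul u (v 1)) w) (.proj 0) ?_
  refine PolyDec.exists_lt (R := fun u v =>
    ν.pmul (v 3) (v 4) = ν.padd (ν.pmul u (v 2)) (v 0)) (.proj _) ?_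
  exact .eq (ν.polyTime₂_pmul.comp (.proj _) (.proj _))
    (ν.polyTime₂_padd.comp (ν.polyTime₂_pmul.comp (.proj _) (.proj _)) (.proj _))

theorem polyTime₃_ksub : PolyTime₃ F ν.ksub :=
  PolyTime.leastBelow (R := fun w v => ν.padd w (v 2) = v 1) (.proj 0)
    (.eq (ν.polyTime₂_padd.comp (.proj _) (.proj _)) (.proj _))

theorem polyTime₃_kinv : PolyTime₃ F ν.kinv :=
  PolyTime.leastBelow (R := fun w v => ν.kmul (v 0) (v 1) (v 2) w = 1) (.proj 0)
    (.eq (ν.polyTime₄_kmul.comp (.proj _) (.proj _) (.proj _) (.proj _)) (.const _))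

theorem kmul_le (Q p x y : ℕ) : ν.kmul Q p x y ≤ Q := (leastBelow_spec _ _).1

section
variable {k p : ℕ} (hm : (ν.dec p).Monic) (hd : (ν.dec p).natDegree = k)

/-- The residue class with number `x`. -/
noncomputable def res (p x : ℕ) : AdjoinRoot (ν.dec p) := AdjoinRoot.mk _ (ν.dec x)

theorem res_one : ν.res p 1 = 1 := by rw [res, dec_one, map_one]

include hm hd in
theorem res_injOn {x y : ℕ} (hx : x < ν.q ^ k) (hy : y < ν.q ^ k) (h : ν.res p x = ν.res p y) :
    x = y := by
  rw [lt_pow_iff] at hx hy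
  rw [res, res, AdjoinRoot.mk_eq_mk] at h
  refine ν.dec_injective (sub_eq_zero.mp (eq_zero_of_dvd_of_degree_lt h ?_))
  rw [degree_eq_natDegree hm.ne_zero, hd]
  exact (degree_sub_le _ _).trans_lt (max_lt hx hy)

include hm hd in
theorem exists_res (a : AdjoinRoot (ν.dec p)) : ∃ x < ν.q ^ k, ν.res p x = a := by
  obtain ⟨f, rfl⟩ := AdjoinRoot.mk_surjective a
  refine ⟨ν.enc (f %ₘ ν.dec p), ?_, ?_⟩
  · rw [enc_lt_pow_iff]
    refine (degree_modByMonic_lt f hm).trans_le ?_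
    rw [degree_eq_natDegree hm.ne_zero, hd]
  · rw [res, dec_enc, AdjoinRoot.mk_eq_mk, modByMonic_eq_sub_mul_div]
    exact ⟨-(f /ₘ ν.dec p), by ring⟩

include hm hd in
-- Division with remainder shows that the search succeeds: the remainder has degree less than `k`,
-- and so has the quotient, because the product has degree at most `2 * k - 2`. Any hit of the
-- search lies in the right residue class.
theorem kmul_spec (hk : 0 < k) {x y : ℕ} (hx : x < ν.q ^ k) (hy : y < ν.q ^ k) :
    ν.kmul (ν.q ^ k) p x y < ν.q ^ k ∧
      ν.res p (ν.kmul (ν.q ^ k) p x y) = ν.res p x * ν.res p y := by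
  have hlt : ν.kmul (ν.q ^ k) p x y < ν.q ^ k := by
    rw [kmul, leastBelow_lt_iff]
    set f := ν.dec x * ν.dec y
    refine ⟨ν.enc (f %ₘ ν.dec p), ?_, ν.enc (f /ₘ ν.dec p), ?_, ?_⟩
    · rw [enc_lt_pow_iff]
      refine (degree_modByMonic_lt f hm).trans_le ?_
      rw [degree_eq_natDegree hm.ne_zero, hd]
    · rw [enc_lt_pow_iff]
      by_cases h0 : f /ₘ ν.dec p = 0
      · rw [h0, degree_zero]
        exact WithBot.bot_lt_coe _
      rw [degree_eq_natDegree h0, natDegree_divByMonic _ hm, hd]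
      have hx0 : ν.dec x ≠ 0 := by
        intro h
        simp [f, h] at h0
      have hy0 : ν.dec y ≠ 0 := by
        intro h
        simp [f, h] at h0
      rw [lt_pow_iff, degree_eq_natDegree hx0] at hx
      rw [lt_pow_iff, degree_eq_natDegree hy0] at hy
      have h1 : f.natDegree = _ := natDegree_mul hx0 hy0
      norm_cast at hx hy ⊢
      omega
    · rw [padd, pmul, pmul, dec_enc, dec_enc, dec_enc, add_comm,
        mul_comm (f /ₘ ν.dec p), modByMonic_add_div]
  refine ⟨hlt, ?_⟩
  obtain ⟨u, -, hu⟩ := (leastBelow_spec _ _).2.2 hlt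
  have h1 : ν.dec x * ν.dec y = ν.dec u * ν.dec p + ν.dec (ν.kmul (ν.q ^ k) p x y) := by
    have := congrArg ν.dec hu
    rwa [padd, pmul, pmul, dec_enc, dec_enc, dec_enc] at this
  rw [res, res, res, ← map_mul, h1, map_add, map_mul, AdjoinRoot.mk_self, mul_zero, zero_add]

theorem ksub_spec {x y : ℕ} (hx : x < ν.q ^ k) (hy : y < ν.q ^ k) :
    ν.ksub (ν.q ^ k) x y < ν.q ^ k ∧
      ν.res p (ν.ksub (ν.q ^ k) x y) = ν.res p x - ν.res p y := by
  have hlt : ν.ksub (ν.q ^ k) x y < ν.q ^ k := by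
    rw [ksub, leastBelow_lt_iff]
    rw [lt_pow_iff] at hx hy
    refine ⟨ν.enc (ν.dec x - ν.dec y), ?_, ?_⟩
    · rw [enc_lt_pow_iff]
      exact (degree_sub_le _ _).trans_lt (max_lt hx hy)
    · rw [padd, dec_enc, sub_add_cancel, enc_dec]
  refine ⟨hlt, ?_⟩
  have h1 := (leastBelow_spec _ _).2.2 hlt
  have h2 := congrArg ν.dec h1
  rw [padd, dec_enc] at h2
  rw [res, res, res, ← map_sub, ← h2, ksub, add_sub_cancel_right]

include hm hd in
theorem kinv_spec (hk : 0 < k) [Fact (Irreducible (ν.dec p))] {x : ℕ} (hx : x < ν.q ^ k)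
    (h0 : ν.res p x ≠ 0) :
    ν.kinv (ν.q ^ k) p x < ν.q ^ k ∧ ν.res p (ν.kinv (ν.q ^ k) p x) = (ν.res p x)⁻¹ := by
  have h1 : 1 < ν.q ^ k := Nat.one_lt_pow hk.ne' ν.one_lt
  have hlt : ν.kinv (ν.q ^ k) p x < ν.q ^ k := by
    rw [kinv, leastBelow_lt_iff]
    obtain ⟨w, hw, hw'⟩ := ν.exists_res hm hd (ν.res p x)⁻¹
    obtain ⟨h2, h3⟩ := ν.kmul_spec hm hd hk hx hw
    refine ⟨w, hw, ν.res_injOn hm hd h2 h1 ?_⟩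
    rw [h3, hw', mul_inv_cancel₀ h0, res_one]
  refine ⟨hlt, ?_⟩
  have h2 := (leastBelow_spec _ _).2.2 hlt
  have h3 := (ν.kmul_spec hm hd hk hx hlt).2
  change ν.kmul (ν.q ^ k) p x (ν.kinv (ν.q ^ k) p x) = 1 at h2
  rw [h2, res_one] at h3
  exact eq_inv_of_mul_eq_one_right h3.symm

end
end Numbering
end RAM

end

/-! ### The Reed-Muller type code and its smooth decoding. -/

section
open Polynomial

/-- A polynomial of degree less than `|K| - 1` sums to zero over the finite field `K`. -/
theorem FiniteField.sum_eval_eq_zero {K : Type*} [Field K] [Fintype K] (f : K[X])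
    (h : f.natDegree < Fintype.card K - 1) : ∑ x, f.eval x = 0 := by
  simp only [eval_eq_sum_range]
  rw [Finset.sum_comm]
  refine Finset.sum_eq_zero fun i hi => ?_
  rw [← Finset.mul_sum, FiniteField.sum_pow_lt_card_sub_one K i
    (by have := Finset.mem_range_succ_iff.mp hi; omega), mul_zero]

namespace RAM
namespace Numbering

variable {F : Type*} [Field F] (ν : Numbering F)

/-! ### Lagrange interpolation -/

/-- The value at `x` of the polynomial that is `1` at the node `y` and `0` at the other nodes `< g`,
on numbers. -/
noncomputable def lagrange (Q p g x y : ℕ) : ℕ :=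
  Nat.rec (motive := fun _ => ℕ) 1 (fun c r => if c = y then r else
    ν.kmul Q p r (ν.kmul Q p (ν.ksub Q x c) (ν.kinv Q p (ν.ksub Q y c)))) g

theorem lagrange_le (Q p g x y : ℕ) : ν.lagrange Q p g x y ≤ Q + 1 := by
  induction g with
  | zero => simp [lagrange]
  | succ g ih =>
    have h : ν.lagrange Q p (g + 1) x y = if g = y then ν.lagrange Q p g x y else
      ν.kmul Q p (ν.lagrange Q p g x y)
        (ν.kmul Q p (ν.ksub Q x g) (ν.kinv Q p (ν.ksub Q y g))) := rfl
    rw [h]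
    split_ifs
    · exact ih
    · exact (ν.kmul_le _ _ _ _).trans (Nat.le_succ _)

theorem polyTime₅_lagrange : PolyTime₅ F ν.lagrange := by
  refine PolyTime.natRec (F := F) (j := 5) (base := fun _ => 1) (cnt := fun v => v 2)
    (step := fun c r v => if c = v 4 then r else ν.kmul (v 0) (v 1) r
      (ν.kmul (v 0) (v 1) (ν.ksub (v 0) (v 3) c) (ν.kinv (v 0) (v 1) (ν.ksub (v 0) (v 4) c))))
    (.const 1) (.proj 2) (.ite (.eq (.proj 0) (.proj _)) (.proj 1) ?_)
    (bd := fun v => v 0 + 1) ((PolyBdd.proj 0).add (.const 1))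
    fun v i hi => ν.lagrange_le (v 0) (v 1) i (v 3) (v 4)
  exact ν.polyTime₄_kmul.comp (.proj _) (.proj _) (.proj 1) (ν.polyTime₄_kmul.comp (.proj _)
    (.proj _) (ν.polyTime₃_ksub.comp (.proj _) (.proj _) (.proj 0)) (ν.polyTime₃_kinv.comp
      (.proj _) (.proj _) (ν.polyTime₃_ksub.comp (.proj _) (.proj _) (.proj 0))))

section
variable {k p : ℕ} [Fact (Irreducible (ν.dec p))]

/-- The polynomial that is `1` at the node `y` and `0` at the other nodes `< g`. -/
noncomputable def nodePoly (p : ℕ) [Fact (Irreducible (ν.dec p))] (g y : ℕ) : (AdjoinRoot (ν.dec p))[X] :=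
  ∏ c ∈ Finset.range g, if c = y then 1 else
    C (ν.res p y - ν.res p c)⁻¹ * (X - C (ν.res p c))

theorem natDegree_nodePoly_le {g y : ℕ} (hy : y < g) : (ν.nodePoly p g y).natDegree ≤ g - 1 := by
  refine (natDegree_prod_le _ _).trans ?_
  refine (Finset.sum_le_sum (g := fun c => if c = y then 0 else 1) fun c _ => ?_).trans ?_
  · split_ifs
    · simp
    · exact (natDegree_C_mul_le _ _).trans (natDegree_X_sub_C_le _)
  · rw [Finset.sum_ite, Finset.sum_const_zero, zero_add, Finset.sum_const, smul_eq_mul, mul_one,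
      Finset.filter_ne', Finset.card_erase_of_mem (Finset.mem_range.mpr hy), Finset.card_range]

theorem eval_nodePoly (g x y : ℕ) : (ν.nodePoly p g y).eval (ν.res p x) =
    ∏ c ∈ Finset.range g, if c = y then 1 else
      (ν.res p x - ν.res p c) * (ν.res p y - ν.res p c)⁻¹ := by
  rw [nodePoly, eval_prod]
  refine Finset.prod_congr rfl fun c _ => ?_
  split_ifs
  · simp
  · simp [mul_comm]

theorem eval_nodePoly_of_ne {g x y : ℕ} (hx : x < g) (hxy : x ≠ y) :
    (ν.nodePoly p g y).eval (ν.res p x) = 0 := by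
  rw [eval_nodePoly]
  refine Finset.prod_eq_zero (Finset.mem_range.mpr hx) ?_
  rw [if_neg hxy, sub_self, zero_mul]

variable (hm : (ν.dec p).Monic) (hd : (ν.dec p).natDegree = k)

include hm hd

theorem res_sub_ne_zero {x y : ℕ} (hx : x < ν.q ^ k) (hy : y < ν.q ^ k) (h : x ≠ y) :
    ν.res p x - ν.res p y ≠ 0 := fun h' =>
  h (ν.res_injOn hm hd hx hy (sub_eq_zero.mp h'))

theorem eval_nodePoly_self {g y : ℕ} (hg : g ≤ ν.q ^ k) (hy : y < g) :
    (ν.nodePoly p g y).eval (ν.res p y) = 1 := by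
  rw [eval_nodePoly]
  refine Finset.prod_eq_one fun c hc => ?_
  split_ifs with h
  · rfl
  · exact mul_inv_cancel₀ (ν.res_sub_ne_zero hm hd (hy.trans_le hg)
      ((Finset.mem_range.mp hc).trans_le hg) (Ne.symm h))

/-- The nodes are the residue classes with numbers below `g`. They are distinct since `g ≤ q ^ k`,
so only nonzero differences are inverted and no search returns its default value. -/
theorem lagrange_spec (hk : 0 < k) {g x y : ℕ} (hg : g ≤ ν.q ^ k) (hx : x < ν.q ^ k)
    (hy : y < ν.q ^ k) :
    ν.lagrange (ν.q ^ k) p g x y < ν.q ^ k ∧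
      ν.res p (ν.lagrange (ν.q ^ k) p g x y) = (ν.nodePoly p g y).eval (ν.res p x) := by
  rw [eval_nodePoly]
  induction g with
  | zero => exact ⟨Nat.one_lt_pow hk.ne' ν.one_lt, by simp [lagrange, res_one]⟩
  | succ g ih =>
    obtain ⟨h1, h2⟩ := ih (by omega)
    have h : ν.lagrange (ν.q ^ k) p (g + 1) x y = if g = y then ν.lagrange (ν.q ^ k) p g x y else
      ν.kmul (ν.q ^ k) p (ν.lagrange (ν.q ^ k) p g x y)
        (ν.kmul (ν.q ^ k) p (ν.ksub (ν.q ^ k) x g)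
          (ν.kinv (ν.q ^ k) p (ν.ksub (ν.q ^ k) y g))) := rfl
    rw [h, Finset.prod_range_succ]
    split_ifs with hgy
    · exact ⟨h1, by rw [h2, mul_one]⟩
    · obtain ⟨h3, h4⟩ := ν.ksub_spec (p := p) hx hg
      obtain ⟨h5, h6⟩ := ν.ksub_spec (p := p) hy hg
      have h7 : ν.res p (ν.ksub (ν.q ^ k) y g) ≠ 0 := by
        rw [h6]
        exact ν.res_sub_ne_zero hm hd hy hg (Ne.symm hgy)
      obtain ⟨h8, h9⟩ := ν.kinv_spec hm hd hk h5 h7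
      obtain ⟨h10, h11⟩ := ν.kmul_spec hm hd hk h3 h8
      obtain ⟨h12, h13⟩ := ν.kmul_spec hm hd hk h1 h10
      exact ⟨h12, by rw [h13, h2, h11, h4, h9, h6]⟩

end

/-! ### The generator matrix of the code -/

/-- The entry in row `z` and column `a` of the generator matrix: the constant coefficient of
a product of values of node polynomials. -/
noncomputable def entry (Q g l z a : ℕ) : ℕ :=
  Nat.rec (motive := fun _ => ℕ) 1 (fun i r => ν.kmul Q (ν.irrPoly Q) r
    (ν.lagrange Q (ν.irrPoly Q) g (digit Q z i) (digit g a i))) l % ν.q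

theorem entry_lt (Q g l z a : ℕ) : ν.entry Q g l z a < ν.q := Nat.mod_lt _ ν.q_pos

theorem polyTime₅_entry : PolyTime₅ F ν.entry := by
  refine polyTime₂_mod.comp (PolyTime.natRec (F := F) (j := 5) (base := fun _ => 1)
    (cnt := fun v => v 2) (step := fun i r v => ν.kmul (v 0) (ν.irrPoly (v 0)) r
      (ν.lagrange (v 0) (ν.irrPoly (v 0)) (v 1) (digit (v 0) (v 3) i) (digit (v 1) (v 4) i)))
    (.const 1) (.proj 2) ?_ (bd := fun v => v 0 + 1) ((PolyBdd.proj 0).add (.const 1)) ?_)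
    (.const _)
  · exact ν.polyTime₄_kmul.comp (.proj _) (ν.polyTime₁_irrPoly.comp (.proj _)) (.proj 1)
      (ν.polyTime₅_lagrange.comp (.proj _) (ν.polyTime₁_irrPoly.comp (.proj _)) (.proj _)
        (polyTime₃_digit.comp (.proj _) (.proj _) (.proj 0))
        (polyTime₃_digit.comp (.proj _) (.proj _) (.proj 0)))
  · intro v i hi
    cases i with
    | zero => simp
    | succ i => exact (ν.kmul_le _ _ _ _).trans (Nat.le_succ _)

/-- The rows of the generator matrix have the smooth decoding property: every message coordinate
is minus the sum of the codeword coordinates in a random set of `q ^ k - 1` positions, each of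
which is uniformly distributed. -/
theorem exists_smooth_decoding [Finite F] {k g l m : ℕ} (hk : 0 < k) (hg1 : 1 < g)
    (hg : g ≤ ν.q ^ k) (hl : l * (g - 1) < ν.q ^ k - 1) (hm : m ≤ g ^ l) (j : Fin m) :
    ∃ pts : Fin ((ν.q ^ k) ^ l) → Fin (ν.q ^ k - 1) → Fin ((ν.q ^ k) ^ l),
      (∀ i, Function.Bijective fun v => pts v i) ∧
      ∀ v, ∀ a : Fin m, ∑ i, ν.val (ν.entry (ν.q ^ k) g l (pts v i) a) = if a = j then -1 else 0 := by
  classical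
  obtain ⟨hmon, hdeg, hirr⟩ := ν.irrPoly_spec hk
  set p := ν.irrPoly (ν.q ^ k) with hp
  have : Fact (Irreducible (ν.dec p)) := ⟨hirr⟩
  set Q := ν.q ^ k with hQ
  have hQ1 : 1 < Q := Nat.one_lt_pow hk.ne' ν.one_lt
  let K := AdjoinRoot (ν.dec p)
  let e : Fin Q ≃ K := Equiv.ofBijective (fun x => ν.res p x)
    ⟨fun x y h => Fin.ext (ν.res_injOn hmon hdeg x.2 y.2 h), fun a => by
      obtain ⟨x, hx, h⟩ := ν.exists_res hmon hdeg a
      exact ⟨⟨x, hx⟩, h⟩⟩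
  let _ : Fintype K := Fintype.ofEquiv _ e
  have hcard : Fintype.card K = Q := by rw [← Fintype.card_congr e, Fintype.card_fin]
  have hcardN : Fintype.card (Fin (Q ^ l)) = Fintype.card (Fin l → K) := by simp [hcard]
  let pt : Fin (Q ^ l) ≃ (Fin l → K) := Equiv.ofBijective
    (fun z i => ν.res p (digit Q z i)) (by
      rw [Fintype.bijective_iff_injective_and_card]
      refine ⟨fun z w h => Fin.ext (digit_ext hQ1 fun i => ?_), hcardN⟩
      by_cases hi : i < l
      · exact ν.res_injOn hmon hdeg (digit_lt (by omega) _ _) (digit_lt (by omega) _ _)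
          (congrFun h ⟨i, hi⟩)
      · rw [digit_of_lt_pow hQ1 z.2 (by omega), digit_of_lt_pow hQ1 w.2 (by omega)])
  -- The constant coefficient carries the code from `K` down to `F`. Decoding survives because it is
  -- a plain sum with signs, and `φ` is `F`-linear with `φ 1 = 1`. On numbers it is the remainder
  -- modulo `q`.
  let φ : K →ₗ[F] F := (lcoeff F 0).comp (AdjoinRoot.modByMonicHom hmon)
  have hφ : ∀ w < Q, φ (ν.res p w) = ν.val (w % ν.q) := by
    intro w hw
    change (AdjoinRoot.modByMonicHom hmon (AdjoinRoot.mk _ (ν.dec w))).coeff 0 = _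
    rw [AdjoinRoot.modByMonicHom_mk, (modByMonic_eq_self_iff hmon).mpr, coeff_dec, digit_zero]
    rw [degree_eq_natDegree hmon.ne_zero, hdeg]
    exact ν.lt_pow_iff.mp hw
  let f : Fin m → (Fin l → K) → K := fun a y =>
    ∏ i : Fin l, (ν.nodePoly p g (digit g a i)).eval (y i)
  have hentry : ∀ z a, ν.val (ν.entry Q g l z a) =
      φ (∏ i : Fin l, (ν.nodePoly p g (digit g a i)).eval (ν.res p (digit Q z i))) := by
    intro z a
    have h : ∀ i, (Nat.rec (motive := fun _ => ℕ) 1 (fun i r => ν.kmul Q p r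
        (ν.lagrange Q p g (digit Q z i) (digit g a i))) i) < Q ∧
        ν.res p (Nat.rec (motive := fun _ => ℕ) 1 (fun i r => ν.kmul Q p r
        (ν.lagrange Q p g (digit Q z i) (digit g a i))) i) = ∏ c ∈ Finset.range i,
          (ν.nodePoly p g (digit g a c)).eval (ν.res p (digit Q z c)) := by
      intro i
      induction i with
      | zero => exact ⟨hQ1, by simp [res_one]⟩
      | succ i ih =>
        obtain ⟨h1, h2⟩ := ν.lagrange_spec hmon hdeg hk hg (x := digit Q z i) (y := digit g a i)
          (digit_lt (by omega) _ _) ((digit_lt (by omega) _ _).trans_le hg)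
        obtain ⟨h3, h4⟩ := ν.kmul_spec hmon hdeg hk ih.1 h1
        exact ⟨h3, by rw [Finset.prod_range_succ, ← ih.2, ← h2]; exact h4⟩
    rw [entry, ← hφ _ (h l).1, (h l).2, Finset.prod_range]
  -- Restricted to a line, `f a` is a polynomial in one variable of degree at most `l * (g - 1) <
  -- |K| - 1`.
  have hline : ∀ a (y v : Fin l → K), ∑ c : K, f a (fun i => y i + c * v i) = 0 := by
    intro a y v
    have h : ∀ c : K, f a (fun i => y i + c * v i) =
        (∏ i : Fin l, (ν.nodePoly p g (digit g a i)).comp (C (y i) + C (v i) * X)).eval c := by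
      intro c
      rw [eval_prod]
      refine Finset.prod_congr rfl fun i _ => ?_
      rw [eval_comp, eval_add, eval_C, eval_mul, eval_C, eval_X, mul_comm (v i)]
    simp only [h]
    refine FiniteField.sum_eval_eq_zero _ (lt_of_le_of_lt ?_ (hcard.symm ▸ hl))
    refine (natDegree_prod_le _ _).trans ?_
    refine (Finset.sum_le_card_nsmul _ _ (g - 1) fun i _ => ?_).trans (by simp)
    refine natDegree_comp_le.trans ?_
    refine (Nat.mul_le_mul (ν.natDegree_nodePoly_le (digit_lt (by omega) _ _))
      (?_ : _ ≤ 1)).trans (mul_one _).le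
    rw [add_comm]
    exact natDegree_linear_le
  -- The grid point whose coordinates are the base `g` digits of `j`. Different `j < m ≤ g ^ l` give
  -- different points, so `f a` is `1` at its own grid point and `0` at the others.
  let node : Fin l → K := fun i => ν.res p (digit g j i)
  have hnode : ∀ a, f a node = if a = j then 1 else 0 := by
    intro a
    split_ifs with h
    · rw [h]
      exact Finset.prod_eq_one fun i _ =>
        ν.eval_nodePoly_self hmon hdeg hg (digit_lt (by omega) _ _)
    · have : ∃ i : Fin l, digit g j i ≠ digit g a i := by
        by_contra! h'
        refine h (Fin.ext (digit_ext hg1 fun i => ?_))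
        by_cases hi : i < l
        · exact (h' ⟨i, hi⟩).symm
        · rw [digit_of_lt_pow hg1 (a.2.trans_le hm) (by omega),
            digit_of_lt_pow hg1 (j.2.trans_le hm) (by omega)]
      obtain ⟨i, hi⟩ := this
      exact Finset.prod_eq_zero (Finset.mem_univ i)
        (ν.eval_nodePoly_of_ne (digit_lt (by omega) _ _) hi)
  have hunits : Fintype.card Kˣ = Q - 1 := by rw [Fintype.card_units, hcard]
  let u : Fin (Q - 1) ≃ Kˣ := (Fintype.equivFinOfCardEq hunits).symm
  -- The queries are the points `node + c * v` with `c ≠ 0`. For fixed `c` the map from the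
  -- direction `v` to the point is bijective; the omitted term `c = 0` is the wanted value, whence
  -- the minus sign.
  refine ⟨fun v i => pt.symm fun c => node c + (u i : K) * pt v c, fun i => ?_, fun v a => ?_⟩
  · refine pt.symm.bijective.comp (Function.Bijective.comp (g := fun (w : Fin l → K) c =>
      node c + (u i : K) * w c) ⟨fun w w' h => funext fun c => ?_, fun w =>
        ⟨fun c => (u i : K)⁻¹ * (w c - node c), funext fun c => ?_⟩⟩ pt.bijective)
    · exact mul_left_cancel₀ (u i).ne_zero (add_left_cancel (congrFun h c))
    · simp
  · have h1 : ∀ y : Fin l → K, ν.val (ν.entry Q g l (pt.symm y) a) = φ (f a y) := by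
      intro y
      rw [hentry]
      have : ∀ i : Fin l, ν.res p (digit Q (pt.symm y) i) = y i := fun i =>
        congrFun (pt.apply_symm_apply y) i
      simp only [this, f]
    simp only [h1]
    rw [Equiv.sum_comp u fun c : Kˣ => φ (f a fun i => node i + (c : K) * pt v i), ← map_sum]
    have h2 := hline a node (pt v)
    rw [← Finset.add_sum_erase _ _ (Finset.mem_univ (0 : K))] at h2
    have h3 : ∑ c : Kˣ, f a (fun i => node i + (c : K) * pt v i) =
        ∑ c ∈ Finset.univ.erase (0 : K), f a (fun i => node i + c * pt v i) := by
      refine Finset.sum_bij (fun c _ => (c : K)) (fun c _ => by simp) (fun c _ d _ h =>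
        Units.ext h) (fun c hc => ?_) fun c _ => rfl
      exact ⟨Units.mk0 c (Finset.ne_of_mem_erase hc), Finset.mem_univ _, rfl⟩
    rw [h3, eq_neg_of_add_eq_zero_right h2, map_neg]
    simp only [zero_mul, add_zero, hnode]
    split_ifs
    · have := hφ 1 hQ1
      rw [res_one, Nat.mod_eq_of_lt ν.one_lt, ν.val_one] at this
      rw [this]
    · simp

end Numbering
end RAM

end

namespace RAM
namespace Numbering

variable {F : Type*} [Field F] (ν : Numbering F)

/-! ### The parameters of the code -/

/-- The binary length of `m`. -/
noncomputable def binLen (m : ℕ) : ℕ := leastBelow (m + 1) fun i => m / 2 ^ i = 0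

theorem polyTime₁_binLen : PolyTime₁ F binLen :=
  PolyTime.leastBelow (R := fun i v => v 0 / 2 ^ i = 0)
    (polyTime₂_add.comp (.proj 0) (.const 1))
    (.eq (polyTime₃_div_pow.comp (.const 2) (.proj _) (.proj _)) (.const 0))

theorem binLen_lt (m : ℕ) : binLen m < m + 1 :=
  leastBelow_lt_iff.mpr ⟨m, Nat.lt_succ_self m, Nat.div_eq_of_lt Nat.lt_two_pow_self⟩

theorem lt_two_pow_binLen (m : ℕ) : m < 2 ^ binLen m := by
  have := (leastBelow_spec _ _).2.2 (binLen_lt m)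
  exact (Nat.div_eq_zero_iff_lt (by positivity)).mp this

theorem two_pow_le_of_lt_binLen {m i : ℕ} (h : i < binLen m) : 2 ^ i ≤ m := by
  have := (leastBelow_spec _ _).2.1 i h
  rwa [Nat.div_eq_zero_iff_lt (by positivity), not_lt] at this

/-- The number of nodes: the least power of `q` whose `b`-th power exceeds the binary length. -/
noncomputable def nodes (b m : ℕ) : ℕ :=
  Nat.rec (motive := fun _ => ℕ) ν.q (fun _ r => if r ^ b ≤ binLen m then ν.q * r else r) (binLen m)

/-- After `i` rounds either every round has multiplied by `q`, or the threshold is already passed.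
Multiplying only below the threshold limits the overshoot to the factor `q ^ b`. Since `q ^ L > L`,
as many rounds as the binary length suffice. -/
theorem nodes_aux (b m i : ℕ) :
    ∃ s, Nat.rec (motive := fun _ => ℕ) ν.q
        (fun _ r => if r ^ b ≤ binLen m then ν.q * r else r) i = ν.q ^ (s + 1) ∧
      (ν.q ^ (s + 1)) ^ b ≤ ν.q ^ b * (binLen m + 1) ∧
      (s = i ∨ binLen m < (ν.q ^ (s + 1)) ^ b) := by
  induction i with
  | zero =>
    refine ⟨0, by simp, ?_, .inl rfl⟩
    simpa using Nat.le_mul_of_pos_right _ (by omega)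
  | succ i ih =>
    obtain ⟨s, h1, h2, h3⟩ := ih
    by_cases h : (ν.q ^ (s + 1)) ^ b ≤ binLen m
    · refine ⟨s + 1, ?_, ?_, .inl ?_⟩
      · change (if _ ^ b ≤ _ then _ else _) = _
        rw [h1, if_pos h, ← pow_succ']
      · rw [pow_succ', mul_pow]
        exact Nat.mul_le_mul_left _ (h.trans (Nat.le_succ _))
      · rcases h3 with h3 | h3 <;> omega
    · refine ⟨s, ?_, h2, .inr (by omega)⟩
      change (if _ ^ b ≤ _ then _ else _) = _
      rw [h1, if_neg h]

theorem nodes_spec {b : ℕ} (hb : 0 < b) (m : ℕ) : ∃ s, ν.nodes b m = ν.q ^ (s + 1) ∧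
    binLen m < ν.nodes b m ^ b ∧ ν.nodes b m ^ b ≤ ν.q ^ b * (binLen m + 1) := by
  obtain ⟨s, h1, h2, h3⟩ := ν.nodes_aux b m (binLen m)
  refine ⟨s, h1, ?_, by rw [nodes, h1]; exact h2⟩
  rw [nodes, h1]
  rcases h3 with h3 | h3
  · calc binLen m < ν.q ^ binLen m := Nat.lt_pow_self ν.one_lt
      _ ≤ ν.q ^ (s + 1) := Nat.pow_le_pow_right ν.q_pos (by omega)
      _ ≤ _ := Nat.le_self_pow hb.ne' _
  · exact h3

theorem one_lt_nodes {b : ℕ} (hb : 0 < b) (m : ℕ) : 1 < ν.nodes b m := by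
  obtain ⟨s, h, -, -⟩ := ν.nodes_spec hb m
  rw [h]
  exact Nat.one_lt_pow (by omega) ν.one_lt

theorem polyTime₁_nodes {b : ℕ} (hb : 0 < b) : PolyTime₁ F (ν.nodes b) := by
  refine PolyTime.natRec (F := F) (j := 1) (base := fun _ => ν.q) (cnt := fun v => binLen (v 0))
    (step := fun _ r v => if r ^ b ≤ binLen (v 0) then ν.q * r else r) (.const _)
    (polyTime₁_binLen.comp (.proj 0))
    (.ite (.le ((polyTime₁_pow b).comp (.proj 1)) (polyTime₁_binLen.comp (.proj _)))
      (polyTime₂_mul.comp (.const _) (.proj 1)) (.proj 1))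
    (bd := fun v => ν.q ^ b * (v 0 + 1 + 1))
    ((PolyBdd.const _).mul (((PolyBdd.proj 0).add (.const 1)).add (.const 1))) ?_
  intro v i _
  obtain ⟨s, h1, h2, -⟩ := ν.nodes_aux b (v 0) i
  rw [h1]
  refine (Nat.le_self_pow hb.ne' _).trans (h2.trans (Nat.mul_le_mul_left _ ?_))
  have := binLen_lt (v 0)
  omega

/-- The number of variables. -/
noncomputable def vars (b m : ℕ) : ℕ := leastBelow (m + 1) fun i => m ≤ min (ν.nodes b m ^ i) m

theorem polyTime₁_vars {b : ℕ} (hb : 0 < b) : PolyTime₁ F (ν.vars b) :=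
  PolyTime.leastBelow (R := fun i v => v 0 ≤ min (ν.nodes b (v 0) ^ i) (v 0))
    (polyTime₂_add.comp (.proj 0) (.const 1))
    (.le (.proj _) (polyTime₃_min_pow.comp ((ν.polyTime₁_nodes hb).comp (.proj _)) (.proj _)
      (.proj _)))

theorem le_nodes_pow_vars {b : ℕ} (hb : 0 < b) (m : ℕ) : m ≤ ν.nodes b m ^ ν.vars b m := by
  have h : ν.vars b m < m + 1 := leastBelow_lt_iff.mpr ⟨m, Nat.lt_succ_self m,
    le_min (Nat.lt_pow_self (ν.one_lt_nodes hb m)).le le_rfl⟩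
  exact (le_min_iff.mp ((leastBelow_spec _ _).2.2 h)).1

theorem nodes_pow_lt {b m i : ℕ} (h : i < ν.vars b m) : ν.nodes b m ^ i < m := by
  have := (leastBelow_spec _ _).2.1 i h
  simpa using this

theorem vars_le {b : ℕ} (hb : 0 < b) (m : ℕ) : ν.vars b m ≤ binLen m := by
  by_contra! h
  have h1 := ν.nodes_pow_lt h
  have h2 := lt_two_pow_binLen m
  have h3 : 2 ^ binLen m ≤ ν.nodes b m ^ binLen m :=
    Nat.pow_le_pow_left (ν.one_lt_nodes hb m) _
  omega

/-- The number of elements of the extension field. -/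
noncomputable def fieldCard (b m : ℕ) : ℕ := ν.nodes b m ^ (b + 1)

theorem polyTime₁_fieldCard {b : ℕ} (hb : 0 < b) : PolyTime₁ F (ν.fieldCard b) :=
  (polyTime₁_pow _).comp (ν.polyTime₁_nodes hb)

/-- The length of the code. -/
noncomputable def codeLen (b m : ℕ) : ℕ :=
  min (ν.nodes b m ^ ν.vars b m) (m * ν.nodes b m) ^ (b + 1)

theorem polyTime₁_codeLen {b : ℕ} (hb : 0 < b) : PolyTime₁ F (ν.codeLen b) :=
  (polyTime₁_pow _).comp (polyTime₃_min_pow.comp (ν.polyTime₁_nodes hb) (ν.polyTime₁_vars hb)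
    (polyTime₂_mul.comp (.proj 0) (ν.polyTime₁_nodes hb)))

theorem codeLen_le (b m : ℕ) : ν.codeLen b m ≤ (m * ν.nodes b m) ^ (b + 1) :=
  Nat.pow_le_pow_left (min_le_right _ _) _

/-- The cutoff `m * g` in the definition is never active, since `g ^ (l - 1) < m` by minimality of
`l`. It is there to make the length visibly polynomially bounded. -/
theorem codeLen_eq {b m : ℕ} (hb : 0 < b) (hm : 0 < m) :
    ν.codeLen b m = ν.fieldCard b m ^ ν.vars b m := by
  have h1 := ν.one_lt_nodes hb m
  have h : ν.nodes b m ^ ν.vars b m ≤ m * ν.nodes b m := by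
    cases hv : ν.vars b m with
    | zero =>
      rw [pow_zero]
      exact Nat.mul_pos hm (by omega)
    | succ i =>
      rw [pow_succ]
      exact Nat.mul_le_mul_right _ (ν.nodes_pow_lt (by omega)).le
  rw [codeLen, min_eq_left h, fieldCard, ← pow_mul, ← pow_mul, mul_comm]

theorem le_codeLen {b m : ℕ} (hb : 0 < b) (hm : 0 < m) : m ≤ ν.codeLen b m := by
  rw [codeLen_eq ν hb hm, fieldCard, ← pow_mul, mul_comm, pow_mul]
  exact (ν.le_nodes_pow_vars hb m).trans (Nat.le_self_pow (by omega) _)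

/-- The number of variables is at most the binary length of `m`, hence less than `g ^ b`, and `(g ^
b - 1) * (g - 1) < g ^ (b + 1) - 1`. This is the degree condition for decoding along lines. -/
theorem vars_mul_lt {b : ℕ} (hb : 0 < b) (m : ℕ) :
    ν.vars b m * (ν.nodes b m - 1) < ν.fieldCard b m - 1 := by
  obtain ⟨s, -, h1, -⟩ := ν.nodes_spec hb m
  have h2 := ν.one_lt_nodes hb m
  have h3 := (ν.vars_le hb m).trans_lt h1
  rw [fieldCard, pow_succ]
  generalize ν.nodes b m ^ b = x at *
  obtain ⟨y, hy⟩ : ∃ y, ν.nodes b m = y + 2 := ⟨ν.nodes b m - 2, by omega⟩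
  rw [hy]
  have h4 : ν.vars b m * (y + 2 - 1) ≤ (x - 1) * (y + 1) := Nat.mul_le_mul (by omega) (by omega)
  obtain ⟨x, rfl⟩ : ∃ x', x = x' + 1 := ⟨x - 1, by omega⟩
  refine h4.trans_lt ?_
  rw [Nat.add_sub_cancel]
  have : (x + 1) * (y + 2) = x * (y + 1) + x + y + 2 := by ring
  omega

/-- The code of dimension `m` has the smooth decoding property. -/
theorem exists_smooth_decoding_entry [Finite F] {b m : ℕ} (hb : 0 < b) (hm : 0 < m) (j : Fin m) :
    ∃ pts : Fin (ν.codeLen b m) → Fin (ν.fieldCard b m - 1) → Fin (ν.codeLen b m),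
      (∀ i, Function.Bijective fun v => pts v i) ∧
      ∀ v, ∀ a : Fin m, ∑ i, ν.val (ν.entry (ν.fieldCard b m) (ν.nodes b m) (ν.vars b m)
        (pts v i) a) = if a = j then -1 else 0 := by
  obtain ⟨s, h1, -, -⟩ := ν.nodes_spec hb m
  have hQ : ν.fieldCard b m = ν.q ^ ((s + 1) * (b + 1)) := by rw [fieldCard, h1, pow_mul]
  have := ν.vars_mul_lt hb m
  rw [codeLen_eq ν hb hm]
  rw [hQ] at this ⊢
  refine ν.exists_smooth_decoding (by positivity) (ν.one_lt_nodes hb m) ?_ this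
    (ν.le_nodes_pow_vars hb m) j
  rw [← hQ]
  exact Nat.le_self_pow (by omega) _

end Numbering
end RAM

/-! ### From row rigidity to global rigidity -/

/-- There are `N / n` disjoint blocks of `n` consecutive columns; take the one with the fewest
differences. Its columns run through all residues modulo `n`, so in a matrix with periodic columns
it shows one full period. -/
theorem exists_block_sum_le {F : Type*} [DecidableEq F] {N n : ℕ} (A B : Fin N → Fin N → F) (hn : 0 < n) (hnN : n ≤ N) :
    ∃ f : Fin n → Fin N, (∀ c, (f c : ℕ) % n = c) ∧
      N / n * ∑ z, hammingDist (fun c => A z (f c)) (fun c => B z (f c)) ≤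
        ∑ z, hammingDist (A z) (B z) := by
  have hw : 0 < N / n := Nat.div_pos hnN hn
  have hlt : ∀ (u : Fin (N / n)) (c : Fin n), (u : ℕ) * n + c < N := by
    intro u c
    have h1 : ((u : ℕ) + 1) * n ≤ N / n * n := Nat.mul_le_mul_right _ u.2
    have h2 := Nat.div_mul_le_self N n
    rw [add_mul] at h1
    have := c.2
    omega
  let f : Fin (N / n) → Fin n → Fin N := fun u c => ⟨(u : ℕ) * n + c, hlt u c⟩
  have key : ∑ u, ∑ z, hammingDist (fun c => A z (f u c)) (fun c => B z (f u c)) ≤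
      ∑ z, hammingDist (A z) (B z) := by
    rw [Finset.sum_comm]
    refine Finset.sum_le_sum fun z _ => ?_
    simp only [hammingDist]
    rw [← Finset.card_sigma]
    refine Finset.card_le_card_of_injOn (fun uc => f uc.1 uc.2) (fun uc h => ?_) ?_
    · simpa using h
    · rintro ⟨u, c⟩ - ⟨u', c'⟩ - h
      have h1 : (u : ℕ) * n + c = u' * n + c' := congrArg Fin.val h
      have hc : (c : ℕ) = c' := by
        have := congrArg (· % n) h1
        simpa [Nat.mul_add_mod', Nat.mod_eq_of_lt c.2, Nat.mod_eq_of_lt c'.2] using this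
      have hu : (u : ℕ) = u' := Nat.eq_of_mul_eq_mul_right hn (by omega)
      rw [Fin.ext hu, Fin.ext hc]
  have : (Finset.univ : Finset (Fin (N / n))).Nonempty := ⟨⟨0, hw⟩, Finset.mem_univ _⟩
  obtain ⟨u, -, hu⟩ := Finset.exists_min_image _
    (fun u => ∑ z, hammingDist (fun c => A z (f u c)) (fun c => B z (f u c))) this
  refine ⟨f u, fun c => ?_, le_trans ?_ key⟩
  · simp only [f]
    rw [Nat.mul_add_mod', Nat.mod_eq_of_lt c.2]
  · exact (by simp : _ = Fintype.card (Fin (N / n)) • _).le.trans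
      (Finset.card_nsmul_le_sum _ _ _ hu)

section
variable {F : Type*} [Field F] [DecidableEq F]

theorem GloballyRigid.rowRigid {m n : ℕ} {A : Matrix (Fin m) (Fin n) F} {r : ℕ} {s t : ℝ}
    (h : GloballyRigid A r s) (hst : m * t ≤ s) : RowRigid A r t := by
  intro B hB
  refine h B (le_trans ?_ hst)
  push_cast
  exact (Finset.sum_le_card_nsmul _ _ t fun i _ => hB i).trans (by simp)

/-- A coordinate in which the two sums differ is one in which some pair of summands differs. -/
theorem hammingDist_neg_sum_le {ι κ : Type*} [Fintype ι] [Fintype κ] (x y : κ → ι → F) :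
    hammingDist (fun c => -∑ i, x i c) (fun c => -∑ i, y i c) ≤ ∑ i, hammingDist (x i) (y i) := by
  classical
  unfold hammingDist
  refine (Finset.card_le_card ?_).trans Finset.card_biUnion_le
  intro c hc
  simp only [Finset.mem_filter, Finset.mem_univ, true_and, Finset.mem_biUnion] at hc ⊢
  by_contra! h
  exact hc (by rw [Finset.sum_congr rfl fun i _ => h i])

/-- A matrix whose rows are smoothly decodable code words formed from the rows of a row rigid
matrix, and whose columns are repeated periodically, is globally rigid. -/
theorem globallyRigid_of_smooth {m n N Q : ℕ} (hn : 0 < n) (hnN : n ≤ N)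
    (E : Fin N → Fin m → F)
    (hE : ∀ j : Fin m, ∃ pts : Fin N → Fin Q → Fin N, (∀ i, Function.Bijective fun v => pts v i) ∧
      ∀ v a, ∑ i, E (pts v i) a = if a = j then -1 else 0)
    (M : Matrix (Fin m) (Fin n) F) (A : Matrix (Fin N) (Fin N) F)
    (hA : ∀ z c, A z c = ∑ a, E z a * M a ⟨(c : ℕ) % n, Nat.mod_lt _ hn⟩)
    {L : ℝ} (hL0 : 0 < L) (hL : 2 * (Q : ℝ) ≤ L) {r t : ℕ} (hM : RowRigid M r (t + 1)) :
    GloballyRigid A r ((N : ℝ) ^ 2 / n * (t / L)) := by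
  intro B hB
  have hN : 0 < N := hn.trans_le hnN
  obtain ⟨f, hf, hfsum⟩ := exists_block_sum_le A B hn hnN
  set D := ∑ z, hammingDist (A z) (B z)
  let e : Fin N → ℕ := fun z => hammingDist (fun c => A z (f c)) (fun c => B z (f c))
  have hex : ∀ j : Fin m, ∃ pts : Fin Q → Fin N, ∑ i, e (pts i) ≤ t ∧
      ∀ a, ∑ i, E (pts i) a = if a = j then -1 else 0 := by
    intro j
    obtain ⟨pts, hbij, hdec⟩ := hE j
    -- Each query position is uniform over `v`, so it meets every row of the code exactly once; a
    -- minimizing `v` is then at most the average.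
    have h1 : ∑ v, ∑ i, e (pts v i) = Q * ∑ z, e z := by
      rw [Finset.sum_comm, Finset.sum_congr rfl fun i _ => (hbij i).sum_comp e]
      simp
    obtain ⟨v, -, hv⟩ := Finset.exists_min_image Finset.univ (fun v => ∑ i, e (pts v i))
      ⟨⟨0, hN⟩, Finset.mem_univ _⟩
    have h2 : N * ∑ i, e (pts v i) ≤ Q * ∑ z, e z := by
      rw [← h1]
      simpa using Finset.card_nsmul_le_sum Finset.univ (fun v => ∑ i, e (pts v i)) _ hv
    refine ⟨pts v, ?_, hdec v⟩
    set S := ∑ i, e (pts v i)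
    have h3 : N * S * (N / n) ≤ Q * D := by
      calc N * S * (N / n) ≤ Q * (∑ z, e z) * (N / n) := Nat.mul_le_mul_right _ h2
        _ = Q * (N / n * ∑ z, e z) := by ring
        _ ≤ Q * D := Nat.mul_le_mul_left _ hfsum
    -- Rounding `N / n` down loses at most a factor of two, which is the `2` in `2 * Q ≤ L`.
    have h4 : N ≤ 2 * n * (N / n) := by
      have h5 := Nat.lt_div_mul_add hn (a := N)
      have h6 : 1 ≤ N / n := Nat.div_pos hnN hn
      nlinarith
    have h3' : (N : ℝ) * S * (N / n : ℕ) ≤ Q * D := by exact_mod_cast h3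
    have h4' : (N : ℝ) ≤ 2 * n * (N / n : ℕ) := by exact_mod_cast h4
    have hN' : (0 : ℝ) < N := by exact_mod_cast hN
    have hn' : (0 : ℝ) < n := by exact_mod_cast hn
    have h7 : (N : ℝ) * N * S ≤ N * N * t := by
      calc (N : ℝ) * N * S ≤ 2 * n * (N / n : ℕ) * N * S := by gcongr
        _ = 2 * n * (N * S * (N / n : ℕ)) := by ring
        _ ≤ 2 * n * (Q * D) := by gcongr
        _ ≤ 2 * n * (Q * ((N : ℝ) ^ 2 / n * (t / L))) := by gcongr
        _ = (2 * Q) * (N ^ 2 * t / L) := by field_simp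
        _ ≤ L * (N ^ 2 * t / L) := by gcongr
        _ = N * N * t := by field_simp
    have h8 : (S : ℝ) ≤ t := le_of_mul_le_mul_left h7 (by positivity)
    exact_mod_cast h8
  choose pts hpts hdec using hex
  let B' : Matrix (Fin N) (Fin n) F := B.submatrix id f
  -- The decoder as a matrix: applied to the chosen block of `A` it returns `M`, and applied to that
  -- of `B` it returns a matrix of rank at most that of `B`. The sum of indicators allows repeated
  -- queries.
  let G : Matrix (Fin m) (Fin N) F := Matrix.of fun j z => -∑ i, if pts j i = z then 1 else 0
  have hG : ∀ j c, (G * B') j c = -∑ i, B (pts j i) (f c) := by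
    intro j c
    simp only [G, B', Matrix.mul_apply, Matrix.of_apply, Matrix.submatrix_apply, id, neg_mul,
      Finset.sum_neg_distrib, Finset.sum_mul, ite_mul, one_mul, zero_mul]
    rw [Finset.sum_comm]
    simp
  refine (hM (G * B') fun j => ?_).trans
    ((Matrix.rank_mul_le_right _ _).trans (Matrix.rank_submatrix_le _ _ _))
  have h1 : M j = fun c => -∑ i, A (pts j i) (f c) := by
    funext c
    have hc : (⟨(f c : ℕ) % n, Nat.mod_lt _ hn⟩ : Fin n) = c := Fin.ext (hf c)
    simp only [hA, hc]
    rw [Finset.sum_comm]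
    simp only [← Finset.sum_mul, hdec]
    simp
  have h2 : (G * B') j = fun c => -∑ i, B (pts j i) (f c) := funext (hG j)
  have h3 : hammingDist (M j) ((G * B') j) ≤ t := by
    rw [h1, h2]
    exact (hammingDist_neg_sum_le (fun i c => A (pts j i) (f c))
      fun i c => B (pts j i) (f c)).trans (hpts j)
  have : ((hammingDist (M j) ((G * B') j) : ℕ) : ℝ) ≤ t := by exact_mod_cast h3
  linarith

/-- The trivial upper bound on row rigidity. -/
theorem RowRigid.add_le {m n : ℕ} {M : Matrix (Fin m) (Fin n) F} {r s : ℕ}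
    (h : RowRigid M r s) : r ≤ n - s := by
  classical
  -- Erasing the last `s` columns changes at most `s` entries per row.
  let B : Matrix (Fin m) (Fin n) F := Matrix.of fun i j => if (j : ℕ) < n - s then M i j else 0
  have hB : B.rank ≤ n - s := by
    let P : Matrix (Fin m) (Fin (n - s)) F :=
      Matrix.of fun i k => M i ⟨k, k.2.trans_le (Nat.sub_le _ _)⟩
    let R : Matrix (Fin (n - s)) (Fin n) F := Matrix.of fun k j => if (k : ℕ) = j then 1 else 0
    have : B = P * R := by
      ext i j
      simp only [B, P, R, Matrix.mul_apply, Matrix.of_apply, mul_ite, mul_one, mul_zero]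
      split_ifs with hj
      · rw [Finset.sum_eq_single ⟨j, hj⟩] <;> simp +contextual [Fin.ext_iff]
      · rw [Finset.sum_eq_zero]
        intro k _
        rw [if_neg]
        have := k.2
        omega
    rw [this]
    exact (Matrix.rank_mul_le_left _ _).trans (Matrix.rank_le_width _)
  refine (h B fun i => ?_).trans hB
  have : hammingDist (M i) (B i) ≤ s := by
    unfold hammingDist
    have h1 : (Finset.univ.filter fun j => M i j ≠ B i j) ⊆
        Finset.univ.filter fun j : Fin n => n - s ≤ (j : ℕ) := by
      intro j hj
      simp only [Finset.mem_filter, Finset.mem_univ, true_and] at hj ⊢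
      by_contra hj'
      exact hj (by simp [B, not_le.mp hj'])
    refine (Finset.card_le_card h1).trans ?_
    have h2 : (Finset.univ.filter fun j : Fin n => n - s ≤ (j : ℕ)).card ≤
        (Finset.Ico (n - s) n).card :=
      Finset.card_le_card_of_injOn (fun j => (j : ℕ)) (fun j hj => by simpa using hj)
        (fun _ _ _ _ h => Fin.ext h)
    rw [Nat.card_Ico] at h2
    omega
  exact_mod_cast this

end

/-! ### Rigid matrices by counting -/

/-- The sum factors over the coordinates: one letter agrees with `b` and each of the others
contributes `x`. With `0 < x ≤ 1` this generating function bounds the size of Hamming balls. -/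
theorem sum_pow_hammingDist {F ι : Type*} [Fintype F] [DecidableEq F] [Fintype ι] [DecidableEq ι]
    (x : ℝ) (b : ι → F) :
    ∑ a : ι → F, x ^ hammingDist a b = (1 + (Fintype.card F - 1) * x) ^ Fintype.card ι := by
  have h1 : ∀ a : ι → F, x ^ hammingDist a b = ∏ i, if a i = b i then 1 else x := by
    intro a
    rw [Finset.prod_ite, Finset.prod_const_one, one_mul, Finset.prod_const]
    rfl
  have h2 : ∀ i, ∑ c : F, (if c = b i then 1 else x) = 1 + (Fintype.card F - 1) * x := by
    intro i
    rw [← Finset.add_sum_erase _ _ (Finset.mem_univ (b i)), if_pos rfl]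
    congr 1
    rw [Finset.sum_congr rfl fun c hc => if_neg (Finset.ne_of_mem_erase hc), Finset.sum_const,
      Finset.card_erase_of_mem (Finset.mem_univ _), Finset.card_univ, nsmul_eq_mul,
      Nat.cast_sub (Fintype.card_pos_iff.mpr ⟨b i⟩), Nat.cast_one]
  simp only [h1]
  rw [← Fintype.piFinset_univ, ← Finset.prod_univ_sum (fun _ => Finset.univ)
    fun i c => if c = b i then (1 : ℝ) else x]
  simp only [h2, Finset.prod_const, Finset.card_univ]

theorem sum_pow_sum_hammingDist {F : Type*} [Fintype F] [DecidableEq F] {N n : ℕ} (x : ℝ)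
    (B : Fin N → Fin n → F) :
    ∑ A : Fin N → Fin n → F, x ^ (∑ z, hammingDist (A z) (B z)) =
      (1 + (Fintype.card F - 1) * x) ^ (N * n) := by
  simp only [← Finset.prod_pow_eq_pow_sum]
  rw [← Fintype.piFinset_univ, ← Finset.prod_univ_sum (fun _ => Finset.univ)
    fun z (a : Fin n → F) => x ^ hammingDist a (B z)]
  simp only [sum_pow_hammingDist, Finset.prod_const, Finset.card_univ, Fintype.card_fin]
  rw [mul_comm N n, pow_mul]

/-- A rank factorization padded with zeros to inner dimension exactly `m`, so that matrices of rank
at most `m` are counted by pairs `(X, Y)`. -/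
theorem Matrix.exists_eq_mul_of_rank_le {F : Type*} [Field F] {N n m : ℕ}
    (B : Matrix (Fin N) (Fin n) F) (h : B.rank ≤ m) :
    ∃ (X : Matrix (Fin N) (Fin m) F) (Y : Matrix (Fin m) (Fin n) F), B = X * Y := by
  let S := Submodule.span F (Set.range B.col)
  have hS : Module.finrank F S = B.rank := (Matrix.rank_eq_finrank_span_cols B).symm
  let b := Module.finBasisOfFinrankEq F S hS
  let emb := Fin.castLE h
  let c : Fin n → S := fun j => ⟨B.col j, Submodule.subset_span ⟨j, rfl⟩⟩
  refine ⟨Matrix.of fun i k => if hk : (k : ℕ) < B.rank then (b ⟨k, hk⟩ : Fin N → F) i else 0,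
    Matrix.of fun k j => if hk : (k : ℕ) < B.rank then b.repr (c j) ⟨k, hk⟩ else 0, ?_⟩
  ext i j
  have h1 : B i j = ∑ k : Fin B.rank, b.repr (c j) k * (b k : Fin N → F) i := by
    have h2 := congrArg (fun s : S => (s : Fin N → F) i) (b.sum_repr (c j))
    simp only [Submodule.coe_sum, Submodule.coe_smul, Finset.sum_apply, Pi.smul_apply,
      smul_eq_mul] at h2
    exact h2.symm
  rw [h1, Matrix.mul_apply]
  refine Finset.sum_of_injOn emb ((Fin.castLE_injective h).injOn) (fun _ _ => Finset.mem_univ _)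
    (fun k _ hk => ?_) fun k _ => ?_
  · have : ¬ (k : ℕ) < B.rank := fun hk' => hk ⟨⟨k, hk'⟩, by simp, rfl⟩
    simp [this]
  · simp [emb, mul_comm]

/-- It says that the `y`-ary entropy at relative distance `2 / 5` is at most `39 / 40`. The case `y
= 2` is numerical, and `y - 1 ≤ (y / 2) ^ 2` reduces the rest to it. -/
theorem pow_mul_pow_le_pow_thirtynine {y : ℝ} (hy : 2 ≤ y) :
    (5 / 3 : ℝ) ^ 40 * (3 * (y - 1) / 2) ^ 16 ≤ y ^ 39 := by
  have h1 : (5 / 3 : ℝ) ^ 40 * (3 / 2) ^ 16 ≤ 2 ^ 39 := by norm_num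
  have h2 : (y - 1) ^ 16 ≤ (y / 2) ^ 39 := by
    calc (y - 1) ^ 16 ≤ ((y / 2) ^ 2) ^ 16 := by
          gcongr
          · linarith
          · nlinarith [sq_nonneg (y - 2)]
      _ = (y / 2) ^ 32 := by rw [← pow_mul]
      _ ≤ (y / 2) ^ 39 := pow_le_pow_right₀ (by linarith) (by norm_num)
  calc (5 / 3 : ℝ) ^ 40 * (3 * (y - 1) / 2) ^ 16
      = (5 / 3 : ℝ) ^ 40 * (3 / 2) ^ 16 * (y - 1) ^ 16 := by rw [mul_div_right_comm, mul_pow]; ring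
    _ ≤ 2 ^ 39 * (y / 2) ^ 39 := by gcongr
    _ = y ^ 39 := by rw [← mul_pow]; congr 1; ring

/-- For `N = 100 m` there is an `N × N` matrix that has distance more than `2 N ^ 2 / 5` from all
matrices of rank at most `m`. -/
theorem exists_rigid_matrix (F : Type*) [Field F] [Finite F] [DecidableEq F] {m : ℕ} (hm : 0 < m) :
    ∃ A : Matrix (Fin (100 * m)) (Fin (100 * m)) F, ∀ B : Matrix (Fin (100 * m)) (Fin (100 * m)) F,
      ∑ z, hammingDist (A z) (B z) ≤ 4000 * m ^ 2 → m < B.rank := by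
  classical
  have := Fintype.ofFinite F
  by_contra! hcon
  set N := 100 * m with hN
  set q := Fintype.card F
  have hq : (2 : ℝ) ≤ q := by exact_mod_cast Fintype.one_lt_card (α := F)
  let T := (Fin N → Fin m → F) × (Fin m → Fin N → F)
  let P : T → Fin N → Fin N → F := fun t =>
    Matrix.of.symm (Matrix.of t.1 * Matrix.of t.2 : Matrix (Fin N) (Fin N) F)
  have hT : (Fintype.card T : ℝ) = q ^ (200 * m ^ 2) := by
    have : Fintype.card T = q ^ (200 * m ^ 2) := by
      simp only [T, Fintype.card_prod, Fintype.card_fun, Fintype.card_fin]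
      rw [← pow_mul, ← pow_mul, ← pow_add]
      congr 1
      rw [hN]
      ring
    rw [this]
    push_cast
    rfl
  -- The optimal weight for relative distance `2 / 5`: each coordinate contributes `1 + (q - 1) * x
  -- = 5 / 3`, of which the part `2 / 3` comes from disagreement.
  let x : ℝ := 2 / (3 * (q - 1))
  have hx0 : 0 < x := div_pos two_pos (by linarith)
  have hx1 : x ≤ 1 := (div_le_one (by linarith)).mpr (by linarith)
  have hsum : ∀ t : T, ∑ A : Fin N → Fin N → F, x ^ (∑ z, hammingDist (A z) (P t z)) =
      ((5 / 3) ^ 40) ^ (250 * m ^ 2) := by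
    intro t
    rw [sum_pow_sum_hammingDist, ← pow_mul]
    congr 1
    · have : (q : ℝ) - 1 ≠ 0 := by linarith
      simp only [x]
      field_simp
      change 3 * ((q : ℝ) - 1) + (q - 1) * 2 = _
      ring
    · rw [hN]
      ring
  -- By assumption every `A` lies within `4000 * m ^ 2 = 16 * (250 * m ^ 2)` changes of some product
  -- `X * Y`; summing over all `A` gives `hcount`.
  have hone : ∀ A : Fin N → Fin N → F, (x ^ 16) ^ (250 * m ^ 2) ≤
      ∑ t : T, x ^ (∑ z, hammingDist (A z) (P t z)) := by
    intro A
    obtain ⟨B, hB, hrank⟩ := hcon A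
    obtain ⟨X, Y, rfl⟩ := B.exists_eq_mul_of_rank_le hrank
    refine le_trans ?_ (Finset.single_le_sum (fun t _ => by positivity)
      (Finset.mem_univ ((X, Y) : T)))
    rw [← pow_mul]
    exact pow_le_pow_of_le_one hx0.le hx1 (hB.trans (by ring_nf; rfl))
  have hcount : ((q : ℝ) ^ 40) ^ (250 * m ^ 2) * (x ^ 16) ^ (250 * m ^ 2) ≤
      q ^ (200 * m ^ 2) * ((5 / 3) ^ 40) ^ (250 * m ^ 2) := by
    have h1 := Finset.sum_le_sum fun (A : Fin N → Fin N → F) (_ : A ∈ Finset.univ) => hone A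
    rw [Finset.sum_comm, Finset.sum_congr rfl fun t _ => hsum t, Finset.sum_const, Finset.sum_const,
      nsmul_eq_mul, nsmul_eq_mul, Finset.card_univ, Finset.card_univ, hT] at h1
    refine le_trans (le_of_eq ?_) h1
    congr 1
    simp only [Fintype.card_fun, Fintype.card_fin]
    push_cast
    rw [← pow_mul, ← pow_mul, hN]
    congr 1
    ring
  have hxy : x * (3 * (q - 1) / 2) = 1 := by
    have : (q : ℝ) - 1 ≠ 0 := by linarith
    simp only [x]
    field_simp
  have hkey : ((q : ℝ) ^ 40) ^ (250 * m ^ 2) ≤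
      q ^ (200 * m ^ 2) * ((q : ℝ) ^ 39) ^ (250 * m ^ 2) := by
    have h1 : ((3 * ((q : ℝ) - 1) / 2) ^ 16) ^ (250 * m ^ 2) * (x ^ 16) ^ (250 * m ^ 2) = 1 := by
      rw [← mul_pow, ← mul_pow, mul_comm _ x, hxy, one_pow, one_pow]
    calc ((q : ℝ) ^ 40) ^ (250 * m ^ 2)
        = ((q : ℝ) ^ 40) ^ (250 * m ^ 2) * (x ^ 16) ^ (250 * m ^ 2) *
          ((3 * ((q : ℝ) - 1) / 2) ^ 16) ^ (250 * m ^ 2) := by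
          rw [mul_assoc, mul_comm ((x ^ 16) ^ _), h1, mul_one]
      _ ≤ q ^ (200 * m ^ 2) * ((5 / 3) ^ 40) ^ (250 * m ^ 2) *
          ((3 * ((q : ℝ) - 1) / 2) ^ 16) ^ (250 * m ^ 2) := by
          refine mul_le_mul_of_nonneg_right hcount ?_
          have : (0 : ℝ) ≤ 3 * (q - 1) / 2 := by linarith
          positivity
      _ = q ^ (200 * m ^ 2) *
          ((5 / 3) ^ 40 * (3 * ((q : ℝ) - 1) / 2) ^ 16) ^ (250 * m ^ 2) := by
          rw [mul_assoc, ← mul_pow]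
      _ ≤ _ := by
          have := pow_mul_pow_le_pow_thirtynine hq
          have h0 : (0 : ℝ) ≤ 3 * (q - 1) / 2 := by linarith
          gcongr
  rw [← pow_mul, ← pow_mul, ← pow_add] at hkey
  -- The exponents of `q` are `10000 * m ^ 2` on the left and only `200 * m ^ 2 + 9750 * m ^ 2` on
  -- the right.
  refine absurd hkey (not_le.mpr (pow_lt_pow_right₀ (by linarith) ?_))
  have : 0 < m ^ 2 := by positivity
  omega

section
open Filter Topology

/-! ### Small dimensions -/

/-- From `log x ≥ log 5 + 1 - 5 / x` and `log 5 ≥ 3 / 2`; the latter is `e ^ 3 ≤ 25`. -/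
theorem two_fifths_mul_log_ge {x : ℝ} (hx : 0 < x) : x - 2 ≤ 2 / 5 * (x * Real.log x) := by
  have h5 : (3 / 2 : ℝ) ≤ Real.log 5 := by
    rw [Real.le_log_iff_exp_le (by norm_num)]
    have h1 : Real.exp (3 / 2) ^ 2 = Real.exp 1 ^ 3 := by
      rw [← Real.exp_nat_mul, ← Real.exp_nat_mul]
      norm_num
    have h2 : Real.exp 1 ^ 3 ≤ 2.7182818286 ^ 3 :=
      pow_le_pow_left₀ (Real.exp_pos _).le Real.exp_one_lt_d9.le _
    refine le_of_sq_le_sq (a := Real.exp (3 / 2)) ?_ (by norm_num)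
    rw [h1]
    refine h2.trans ?_
    norm_num
  have h1 : 1 - (x / 5)⁻¹ ≤ Real.log (x / 5) := Real.one_sub_inv_le_log_of_pos (by positivity)
  rw [Real.log_div hx.ne' (by norm_num), inv_div] at h1
  have h2 : x * (5 / 2 - 5 / x) ≤ x * Real.log x := by
    gcongr
    linarith
  have h3 : x * (5 / 2 - 5 / x) = 5 / 2 * x - 5 := by field_simp
  linarith

/-- Row rigidity forces `r = 0` or `r + t + 1 ≤ n`. For `r > 0` and `m ≥ 3` this gives `t ≤ n - 2`,
so `t / (log m) ^ (1 + α) ≤ 2 * n / 5`: at most `2 / 5` of all entries may change, and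
`exists_rigid_matrix` leaves rank above `m ≥ r`. For `m ≤ 2` it forces `t = 0`, and the identity
matrix does. The matrix depends on `m` alone, so it can be tabulated. -/
theorem exists_matrix_of_small (F : Type*) [Field F] [Finite F] [DecidableEq F] (m : ℕ) :
    ∃ (N : ℕ) (A : Matrix (Fin N) (Fin N) F), N ≤ m ^ 8 ∧
      ∀ n, 0 < n → n ≤ m → ∀ M : Matrix (Fin m) (Fin n) F, ∀ α : ℝ, 0 < α → ∀ r t : ℕ,
        RowRigid M r ((t : ℝ) + 1) →
          GloballyRigid A r ((N : ℝ) ^ 2 / n * (t / Real.log m ^ (1 + α))) := by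
  have key : ∀ {n : ℕ} {M : Matrix (Fin m) (Fin n) F} {r t : ℕ}, RowRigid M r ((t : ℝ) + 1) →
      r = 0 ∨ r + t + 1 ≤ n := by
    intro n M r t h
    have := RowRigid.add_le (s := t + 1) (by exact_mod_cast h)
    omega
  by_cases hm : m ≤ 2
  · refine ⟨m, 1, Nat.le_self_pow (by norm_num) _, fun n hn hnm M α hα r t h B hB => ?_⟩
    rcases key h with rfl | h1
    · exact Nat.zero_le _
    by_cases hr : r = 0
    · omega
    obtain rfl : t = 0 := by omega
    have h2 : ∑ i, hammingDist ((1 : Matrix (Fin m) (Fin m) F) i) (B i) = 0 := by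
      have h3 : ((∑ i, hammingDist ((1 : Matrix (Fin m) (Fin m) F) i) (B i) : ℕ) : ℝ) ≤ 0 := by
        simpa using hB
      exact Nat.le_zero.mp (by exact_mod_cast h3)
    have h3 : B = 1 := by
      funext i
      exact (hammingDist_eq_zero.mp (Finset.sum_eq_zero_iff.mp h2 i (Finset.mem_univ i))).symm
    rw [h3, Matrix.rank_one, Fintype.card_fin]
    omega
  · obtain ⟨A, hA⟩ := exists_rigid_matrix F (m := m) (by omega)
    refine ⟨100 * m, A, ?_, fun n hn hnm M α hα r t h B hB => ?_⟩
    -- The exponent `8` comes from `100 ≤ 3 ^ 7`.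
    · have h1 : 3 ^ 7 ≤ m ^ 7 := Nat.pow_le_pow_left (by omega) 7
      rw [pow_succ]
      exact Nat.mul_le_mul_right _ (le_trans (by norm_num) h1)
    · rcases key h with rfl | h1
      · exact Nat.zero_le _
      by_cases hr : r = 0
      · omega
      suffices h2 : ∑ z, hammingDist (A z) (B z) ≤ 4000 * m ^ 2 by
        have := hA B h2
        omega
      have hm3 : (3 : ℝ) ≤ m := by exact_mod_cast (by omega : 3 ≤ m)
      have hlog1 : 1 ≤ Real.log m := by
        rw [Real.le_log_iff_exp_le (by linarith)]
        have := Real.exp_one_lt_d9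
        linarith
      have hlog : Real.log m ≤ Real.log m ^ (1 + α) := by
        conv_lhs => rw [← Real.rpow_one (Real.log m)]
        exact Real.rpow_le_rpow_of_exponent_le hlog1 (by linarith)
      have hn' : (0 : ℝ) < n := by exact_mod_cast hn
      have hnm' : (n : ℝ) ≤ m := by exact_mod_cast hnm
      have ht : (t : ℝ) + 2 ≤ n := by exact_mod_cast (by omega : t + 2 ≤ n)
      have h3 := two_fifths_mul_log_ge (x := m) (by linarith)
      have h4 : (t : ℝ) * m ≤ 2 / 5 * (n * m * Real.log m) := by
        have h5 : (t : ℝ) * m ≤ n * (m - 2) := by nlinarith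
        have h6 : (n : ℝ) * (m - 2) ≤ n * (2 / 5 * (m * Real.log m)) := by gcongr
        linarith
      have h5 : (t : ℝ) / Real.log m ^ (1 + α) ≤ 2 / 5 * n := by
        rw [div_le_iff₀ (by linarith)]
        have h6 : (t : ℝ) ≤ 2 / 5 * n * Real.log m :=
          le_of_mul_le_mul_right (by linarith) (by linarith : (0 : ℝ) < m)
        refine h6.trans ?_
        gcongr
      have h6 : ((∑ z, hammingDist (A z) (B z) : ℕ) : ℝ) ≤ 4000 * (m : ℝ) ^ 2 := by
        refine hB.trans ?_
        calc ((100 * m : ℕ) : ℝ) ^ 2 / n * (t / Real.log m ^ (1 + α))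
            ≤ ((100 * m : ℕ) : ℝ) ^ 2 / n * (2 / 5 * n) := by gcongr
          _ = 4000 * (m : ℝ) ^ 2 := by push_cast; field_simp; ring
      exact_mod_cast h6

/-! ### Large dimensions -/

namespace RAM.Numbering

variable {F : Type*} [Field F] (ν : Numbering F)

theorem binLen_add_one_le {m : ℕ} (hm : 3 ≤ m) : (binLen m : ℝ) + 1 ≤ 4 * Real.log m := by
  have hm3 : (3 : ℝ) ≤ m := by exact_mod_cast hm
  have hlog1 : 1 ≤ Real.log m := by
    rw [Real.le_log_iff_exp_le (by linarith)]
    have := Real.exp_one_lt_d9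
    linarith
  rcases Nat.eq_zero_or_pos (binLen m) with h | h
  · rw [h]
    push_cast
    linarith
  · have h1 := two_pow_le_of_lt_binLen (Nat.sub_one_lt_of_lt h)
    have h2 : ((binLen m - 1 : ℕ) : ℝ) * Real.log 2 ≤ Real.log m := by
      rw [← Real.log_pow]
      exact Real.log_le_log (by positivity) (by exact_mod_cast h1)
    rw [Nat.cast_sub h, Nat.cast_one] at h2
    have h3 := Real.log_two_gt_d9
    have h4 : (1 : ℝ) ≤ binLen m := by exact_mod_cast h
    nlinarith

/-- Since `g ^ b ≤ c * log m`, the field has `(g ^ b) ^ (1 + 1 / b) ≤ (c * log m) ^ (1 + 1 / b)`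
elements. The spare power `(log m) ^ (α - 1 / b)` absorbs the constants for large `m`. -/
theorem eventually_parameters {b : ℕ} (hb : 0 < b) {α : ℝ} (hα : 1 / (b : ℝ) < α) :
    ∀ᶠ m : ℕ in atTop, 3 ≤ m ∧ ν.nodes b m ≤ m ∧
      2 * (ν.fieldCard b m : ℝ) ≤ Real.log m ^ (1 + α) := by
  have hb' : (0 : ℝ) < b := by exact_mod_cast hb
  set c : ℝ := (ν.q : ℝ) ^ b * 4 with hc
  have hc0 : 0 < c := by
    have := ν.q_pos
    positivity
  have hlog : Tendsto (fun m : ℕ => Real.log m) atTop atTop :=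
    Real.tendsto_log_atTop.comp tendsto_natCast_atTop_atTop
  have e1 : ∀ᶠ m : ℕ in atTop, c * Real.log m ≤ m := by
    have h1 := (Real.isLittleO_log_id_atTop.bound (c := c⁻¹) (by positivity)).natCast_atTop
    filter_upwards [h1, eventually_ge_atTop 3] with m h1 h2
    have hm3 : (3 : ℝ) ≤ m := by exact_mod_cast h2
    rw [Real.norm_of_nonneg (Real.log_nonneg (by linarith)), id,
      Real.norm_of_nonneg (by linarith), inv_mul_eq_div, le_div_iff₀ hc0] at h1
    linarith
  have e2 : ∀ᶠ m : ℕ in atTop, 2 * c ^ (1 + 1 / (b : ℝ)) ≤ Real.log m ^ (α - 1 / b) :=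
    ((tendsto_rpow_atTop (by linarith)).comp hlog).eventually_ge_atTop _
  filter_upwards [e1, e2, eventually_ge_atTop 3, hlog.eventually_ge_atTop 1] with m h1 h2 h3 h4
  obtain ⟨s, -, -, h5⟩ := ν.nodes_spec hb m
  have h6 : (ν.nodes b m : ℝ) ^ b ≤ c * Real.log m := by
    have h7 : (ν.nodes b m : ℝ) ^ b ≤ (ν.q : ℝ) ^ b * (binLen m + 1) := by exact_mod_cast h5
    refine h7.trans ?_
    rw [hc, mul_assoc]
    gcongr
    exact binLen_add_one_le h3
  refine ⟨h3, ?_, ?_⟩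
  · have h7 : (ν.nodes b m : ℝ) ≤ (ν.nodes b m : ℝ) ^ b := by
      exact_mod_cast Nat.le_self_pow hb.ne' _
    exact_mod_cast h7.trans (h6.trans h1)
  · have h7 : (ν.fieldCard b m : ℝ) = ((ν.nodes b m : ℝ) ^ b) ^ (1 + 1 / (b : ℝ)) := by
      rw [fieldCard, ← Real.rpow_natCast _ b, ← Real.rpow_mul (by positivity)]
      push_cast
      rw [← Real.rpow_natCast]
      congr 1
      push_cast
      field_simp
    calc 2 * (ν.fieldCard b m : ℝ) ≤ 2 * (c * Real.log m) ^ (1 + 1 / (b : ℝ)) := by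
          rw [h7]
          gcongr
      _ = 2 * c ^ (1 + 1 / (b : ℝ)) * Real.log m ^ (1 + 1 / (b : ℝ)) := by
          rw [Real.mul_rpow hc0.le (by linarith), mul_assoc]
      _ ≤ Real.log m ^ (α - 1 / b) * Real.log m ^ (1 + 1 / (b : ℝ)) := by gcongr
      _ = Real.log m ^ (1 + α) := by
          rw [← Real.rpow_add (by linarith)]
          congr 1
          ring

end RAM.Numbering

end

/-! ### The main theorem: combining the code, the tables and the machine. -/

theorem mainTheorem4 :
    ∃ C : ℝ, 0 < C ∧
      ∀ (F : Type*) [Field F] [Finite F] [DecidableEq F] (α : ℝ), 0 < α →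
        ∃ (alg : RAM.Program F) (P : Polynomial ℕ),
          ∀ (m n : ℕ), n ≤ m → ∀ M : Matrix (Fin m) (Fin n) F,
            ∃ (T : ℕ) (s : RAM.State F) (m' : ℕ) (A : Matrix (Fin m') (Fin m') F),
              RAM.Run alg (RAM.inputState M) T s ∧
              T ≤ P.eval (m + n) ∧
              RAM.Outputs s A ∧
              (m' : ℝ) ≤ (m : ℝ) ^ (C * (1 + 1 / α)) ∧
              ∀ r t : ℕ, RowRigid M r ((t : ℝ) + 1) →
                GloballyRigid A r
                  ((m' : ℝ) ^ 2 / (n : ℝ) * ((t : ℝ) / Real.log (m : ℝ) ^ (1 + α))) ∧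
                RowRigid A r
                  ((m' : ℝ) / (n : ℝ) * ((t : ℝ) / Real.log (m : ℝ) ^ (1 + α))) := by
  classical
  -- The tables for small `m` have size at most `m ^ 8`. The code needs only the exponent `2 * (b +
  -- 1) ≤ 4 + 2 / α`, because `b = ⌊1 / α⌋ + 1`.
  refine ⟨8, by norm_num, fun F _ _ _ α hα => ?_⟩
  obtain ⟨ν, -⟩ := RAM.exists_numbering F
  set b := ⌊1 / α⌋₊ + 1 with hbdef
  have hb : 0 < b := Nat.succ_pos _
  have hb1 : 1 / (b : ℝ) < α := by
    rw [one_div_lt (by exact_mod_cast hb) hα, hbdef]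
    push_cast
    exact Nat.lt_floor_add_one _
  have hb2 : (2 * (b + 1) : ℝ) ≤ 8 * (1 + 1 / α) := by
    have h1 := Nat.floor_le (show 0 ≤ 1 / α by positivity)
    have h2 : 0 < 1 / α := by positivity
    rw [hbdef]
    push_cast
    linarith
  obtain ⟨m₀, hm₀⟩ := Filter.eventually_atTop.mp (ν.eventually_parameters hb hb1)
  choose Ns As hNs hAs using exists_matrix_of_small F
  -- the finitely many matrices for small dimensions, as tables
  let tabN : ℕ → ℕ → ℕ := fun m i => if m ≤ m₀ ∧ i = 0 then Ns m else 0
  let tabA : ℕ → ℕ → ℕ := fun m i => if h : m ≤ m₀ ∧ i < Ns m * Ns m then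
    ν.code (As m ⟨i / Ns m, Nat.div_lt_of_lt_mul h.2⟩
      ⟨i % Ns m, Nat.mod_lt _ (Nat.pos_of_mul_pos_left (Nat.zero_lt_of_lt h.2))⟩) else 0
  have htabN : RAM.PolyTime₂ F tabN := by
    refine RAM.polyTime₂_of_support (m₀ + 1) fun x y h => ?_
    by_contra h'
    exact h (if_neg (by omega))
  have htabA : RAM.PolyTime₂ F tabA := by
    refine RAM.polyTime₂_of_support (m₀ + 1 + ∑ x ∈ Finset.range (m₀ + 1), Ns x * Ns x)
      fun x y h => ?_
    by_cases h' : x ≤ m₀ ∧ y < Ns x * Ns x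
    · have : Ns x * Ns x ≤ ∑ x ∈ Finset.range (m₀ + 1), Ns x * Ns x :=
        Finset.single_le_sum (f := fun x => Ns x * Ns x) (fun _ _ => Nat.zero_le _)
          (Finset.mem_range.mpr (Nat.lt_succ_of_le h'.1))
      omega
    · exact absurd (dif_neg h') h
  -- For `n = 0` the output is the empty matrix, so that no input position is ever read. Otherwise
  -- `W` supplies the table entries for small `m`, and `E` the code coefficients for large `m`;
  -- `pos` locates row `a` of the input at the output column reduced modulo `n`.
  let N : ℕ → ℕ → ℕ := fun m n =>
    if n = 0 then 0 else if m ≤ m₀ then tabN m 0 else ν.codeLen b m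
  let W : ℕ → ℕ → ℕ → ℕ := fun m _ i => if m ≤ m₀ then tabA m i else 0
  let E : ℕ → ℕ → ℕ → ℕ → ℕ := fun m _ i a => if m ≤ m₀ then 0 else
    ν.entry (ν.fieldCard b m) (ν.nodes b m) (ν.vars b m) (i / ν.codeLen b m) a
  let pos : ℕ → ℕ → ℕ → ℕ → ℕ := fun m n i a => a * n + i % ν.codeLen b m % n
  have hlen := ν.polyTime₁_codeLen hb
  have hN : RAM.PolyTime₂ F N := .ite (.eq (.proj 1) (.const 0)) (.const 0)
    (.ite (.le (.proj 0) (.const m₀)) (htabN.comp (.proj 0) (.const 0)) (hlen.comp (.proj 0)))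
  have hW : RAM.PolyTime₃ F W :=
    .ite (.le (.proj 0) (.const m₀)) (htabA.comp (.proj 0) (.proj 2)) (.const 0)
  have hE : RAM.PolyTime₄ F E := .ite (.le (.proj 0) (.const m₀)) (.const 0)
    (ν.polyTime₅_entry.comp ((ν.polyTime₁_fieldCard hb).comp (.proj 0))
      ((ν.polyTime₁_nodes hb).comp (.proj 0)) ((ν.polyTime₁_vars hb).comp (.proj 0))
      (RAM.polyTime₂_div.comp (.proj 2) (hlen.comp (.proj 0))) (.proj 3))
  have hpos : RAM.PolyTime₄ F pos := RAM.polyTime₂_add.comp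
    (RAM.polyTime₂_mul.comp (.proj 3) (.proj 1)) (RAM.polyTime₂_mod.comp
      (RAM.polyTime₂_mod.comp (.proj 2) (hlen.comp (.proj 0))) (.proj 1))
  obtain ⟨alg, e, halg⟩ := RAM.exists_program hN hW hE hpos ν.val ν.q
    (fun m n i => by
      simp only [W, tabA]
      split_ifs
      exacts [ν.code_lt _, ν.q_pos, ν.q_pos])
    (fun m n i a => by
      simp only [E]
      split_ifs
      exacts [ν.q_pos, ν.entry_lt _ _ _ _ _])
  refine ⟨alg, (Polynomial.X + 2) ^ e, fun m n hnm M => ?_⟩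
  obtain ⟨T, s, hrun, hT, hs0, hs⟩ := halg m n M (by
    intro i hi a ha
    rcases Nat.eq_zero_or_pos n with rfl | hn
    · simp [N] at hi
    · have h1 := Nat.mod_lt (i % ν.codeLen b m) hn
      have h2 : (a + 1) * n ≤ m * n := Nat.mul_le_mul_right _ ha
      rw [add_mul] at h2
      simp only [pos]
      omega)
  let A : Matrix (Fin (N m n)) (Fin (N m n)) F :=
    Matrix.of fun i j => s.field ((i : ℕ) * N m n + j)
  refine ⟨T, s, N m n, A, hrun, by simpa using hT, ⟨hs0, fun i j => rfl⟩, ?_, ?_⟩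
  · have hpow : (m : ℝ) ^ (8 : ℝ) ≤ (m : ℝ) ^ (8 * (1 + 1 / α)) ∨ m = 0 := by
      rcases Nat.eq_zero_or_pos m with h | h
      · exact .inr h
      · refine .inl (Real.rpow_le_rpow_of_exponent_le (by exact_mod_cast h) ?_)
        have : 0 < 1 / α := by positivity
        linarith
    by_cases hn : n = 0
    · rw [show N m n = 0 from if_pos hn, Nat.cast_zero]
      positivity
    rcases hpow with hpow | hpow
    · by_cases hm : m ≤ m₀
      · refine le_trans ?_ hpow
        simp only [N, if_neg hn, if_pos hm, tabN]
        rw [if_pos ⟨hm, trivial⟩]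
        exact_mod_cast hNs m
      · simp only [N, if_neg hn, if_neg hm]
        obtain ⟨h3, h4, -⟩ := hm₀ m (by omega)
        have h5 : ν.codeLen b m ≤ m ^ (2 * (b + 1)) := by
          refine (ν.codeLen_le b m).trans ?_
          rw [pow_mul]
          exact Nat.pow_le_pow_left (by rw [sq]; exact Nat.mul_le_mul_left _ h4) _
        calc (ν.codeLen b m : ℝ) ≤ (m : ℝ) ^ (2 * (b + 1)) := by exact_mod_cast h5
          _ = (m : ℝ) ^ (2 * (b + 1) : ℝ) := by
            rw [← Real.rpow_natCast]
            push_cast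
            rfl
          _ ≤ _ := Real.rpow_le_rpow_of_exponent_le (by exact_mod_cast (by omega : 1 ≤ m)) hb2
    · omega
  · intro r t hM
    suffices h : GloballyRigid A r
        ((N m n : ℝ) ^ 2 / n * ((t : ℝ) / Real.log (m : ℝ) ^ (1 + α))) from
      ⟨h, h.rowRigid (le_of_eq (by ring))⟩
    rcases Nat.eq_zero_or_pos n with rfl | hn
    -- Without columns, row rigidity forces `r = 0`.
    · intro B _
      have h1 := RowRigid.add_le (s := t + 1) (by exact_mod_cast hM)
      omega
    by_cases hm : m ≤ m₀
    · have hNm : N m n = Ns m := by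
        simp only [N, if_neg hn.ne', if_pos hm, tabN]
        exact if_pos ⟨hm, trivial⟩
      have hA : ∀ i j : Fin (N m n), A i j = As m (i.cast hNm) (j.cast hNm) := by
        intro i j
        have hlt : (i : ℕ) * N m n + j < N m n * N m n := by
          have h2 : ((i : ℕ) + 1) * N m n ≤ N m n * N m n := Nat.mul_le_mul_right _ i.2
          have := j.2
          rw [add_mul] at h2
          omega
        change s.field _ = _
        rw [hs _ hlt]
        simp only [E, if_pos hm, ν.val_zero, zero_mul, Finset.sum_const_zero, add_zero, W, tabA]
        have hlt' : m ≤ m₀ ∧ (i : ℕ) * N m n + j < Ns m * Ns m := ⟨hm, hNm ▸ hlt⟩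
        rw [dif_pos hlt', ν.val_code]
        have h0 : 0 < Ns m := by
          have := i.2
          omega
        have hj : (j : ℕ) < Ns m := hNm ▸ j.2
        congr 1
        · refine Fin.ext ?_
          simp only [hNm, Fin.val_cast]
          rw [mul_comm, Nat.mul_add_div h0, Nat.div_eq_of_lt hj, add_zero]
        · refine Fin.ext ?_
          simp only [hNm, Fin.val_cast]
          rw [Nat.mul_add_mod', Nat.mod_eq_of_lt hj]
      have h : ∀ k (hk : k = Ns m) (A : Matrix (Fin k) (Fin k) F),
          (∀ i j, A i j = As m (i.cast hk) (j.cast hk)) →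
          GloballyRigid A r ((k : ℝ) ^ 2 / n * ((t : ℝ) / Real.log (m : ℝ) ^ (1 + α))) := by
        rintro _ rfl A hA
        rw [show A = As m from Matrix.ext hA]
        exact hAs m n hn hnm M α hα r t hM
      exact h _ hNm A hA
    · obtain ⟨h3, -, h5⟩ := hm₀ m (by omega)
      have hm0 : 0 < m := by omega
      have hNm : N m n = ν.codeLen b m := by simp only [N, if_neg hn.ne', if_neg hm]
      have hdec := ν.exists_smooth_decoding_entry hb hm0
      have hle := ν.le_codeLen hb hm0
      have hA : ∀ z c : Fin (N m n), A z c = ∑ a : Fin m,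
          ν.val (ν.entry (ν.fieldCard b m) (ν.nodes b m) (ν.vars b m) z a) *
            M a ⟨(c : ℕ) % n, Nat.mod_lt _ hn⟩ := by
        intro z c
        have hlt : (z : ℕ) * N m n + c < N m n * N m n := by
          have h2 : ((z : ℕ) + 1) * N m n ≤ N m n * N m n := Nat.mul_le_mul_right _ z.2
          have := c.2
          rw [add_mul] at h2
          omega
        change s.field _ = _
        rw [hs _ hlt]
        have h0 : 0 < N m n := Nat.zero_lt_of_lt z.2
        have hdiv : ((z : ℕ) * N m n + c) / N m n = z := by
          rw [mul_comm, Nat.mul_add_div h0, Nat.div_eq_of_lt c.2, add_zero]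
        have hmod : ((z : ℕ) * N m n + c) % N m n = c := by
          rw [Nat.mul_add_mod', Nat.mod_eq_of_lt c.2]
        simp only [E, if_neg hm, W, pos, ν.val_zero, zero_add, ← hNm, hdiv, hmod]
        rw [Finset.sum_range]
        refine Finset.sum_congr rfl fun a _ => ?_
        rw [← RAM.inputState_field M a]
      clear_value A
      revert A
      rw [hNm]
      intro A hA
      have hL : 0 < Real.log (m : ℝ) ^ (1 + α) :=
        Real.rpow_pos_of_pos (Real.log_pos (by exact_mod_cast (by omega : 1 < m))) _
      -- The number of queries is `fieldCard - 1`, less than the field size bounded by `h5`.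
      refine globallyRigid_of_smooth hn (hnm.trans hle)
        (fun z a => ν.val (ν.entry (ν.fieldCard b m) (ν.nodes b m) (ν.vars b m) z a))
        hdec M A hA hL (le_trans ?_ h5) hM
      gcongr
      exact Nat.sub_le _ _
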